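/- By an operad we mean a symmetric coloured operad (in sets). By a tree we mean a finite non-planar rooted tree $T$: it has a finite set of edges with a distinguished root edge, and a set of vertices; every vertex has exactly one output edge and a finite (possibly empty) set of input edges; every edge is the output of at most one vertex (edges that are the output of no vertex are the leaves); every edge other than the root is an input of exactly one vertex, the root is an input of none; and from every edge one reaches the root by descending through vertices. The tree $T$ generates an operad $\Omega(T)$: its colours are the edges of $T$, and it is the free operad with one generating operation for each vertex of $T$, going from the input edges of the vertex (taken in any chosen order) to its output edge. Let $\Omega$ be the category whose objects are trees and whose morphisms $S \to T$ are the morphisms of operads $\Omega(S) \to \Omega(T)$. **Theorem.** The category $\Omega$ is aspherical (weakly contractible): the unique functor from $\Omega$ to the terminal category induces a weak homotopy equivalence on nerves, that is, the induced map between the geometric realizations of the nerves is bijective on path components and on all homotopy groups at all base points. -/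

import Mathlib

open CategoryTheory

namespace Dendroidal

/-! ### Weak equivalences of spaces, of simplicial sets and of categories -/

section Homotopy

open scoped Topology Topology.Homotopy

variable {X Y : Type*} [TopologicalSpace X] [TopologicalSpace Y]

/-- The map induced by a continuous map on sets of path components. -/
def mapPathComponents (f : C(X, Y)) : ZerothHomotopy X → ZerothHomotopy Y :=
  Quotient.map f fun _ _ h => h.map f.continuous

/-- The image of a generalized loop (a map from a cube that is constant on the boundary)
under a continuous map. -/
def mapGenLoop (f : C(X, Y)) {n : ℕ} {x : X} (γ : Ω^ (Fin n) X x) : Ω^ (Fin n) Y (f x) :=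
  ⟨f.comp γ.1, fun y hy => congrArg f (γ.2 y hy)⟩

/-- The map `π_n(X, x) → π_n(Y, f x)` induced by a continuous map `f`. -/
def mapHomotopyGroup (f : C(X, Y)) (n : ℕ) (x : X) : π_ n X x → π_ n Y (f x) :=
  Quotient.map (mapGenLoop f) fun _ _ h =>
    ContinuousMap.HomotopicRel.comp_continuousMap h f

/-- Weak homotopy equivalences of topological spaces: bijective on path components, and on
all homotopy groups at all base points. -/
def IsWeakHomotopyEquiv (f : C(X, Y)) : Prop :=
  Function.Bijective (mapPathComponents f) ∧
    ∀ n : ℕ, 1 ≤ n → ∀ x : X, Function.Bijective (mapHomotopyGroup f n x)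

end Homotopy

universe v u

/-- Weak homotopy equivalences of simplicial sets: the geometric realization is a weak homotopy
equivalence. -/
def SSetWeakEquiv {X Y : SSet.{u}} (f : X ⟶ Y) : Prop :=
  IsWeakHomotopyEquiv (SSet.toTop.map f).hom

/-- A functor is a weak equivalence if its nerve is a weak homotopy equivalence. -/
def IsWeakEquivalence {C D : Type u} [Category.{v} C] [Category.{v} D] (F : C ⥤ D) : Prop :=
  SSetWeakEquiv (nerveMap F)

/-- A category is aspherical (weakly contractible) if the unique functor to the terminal
category is a weak equivalence. -/
def IsAspherical (C : Type u) [Category.{v} C] : Prop :=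
  IsWeakEquivalence (Cat.chosenTerminalIsTerminal.{v, u}.from (Cat.of C)).toFunctor

/-! ### Symmetric coloured operads -/

/-- The concatenation `(b_{11}, …, b_{1 m_1}, …, b_{n1}, …, b_{n m_n})` of a family of tuples. -/
def concat {A : Type} {n : ℕ} {m : Fin n → ℕ} (b : ∀ i, Fin (m i) → A) :
    Fin (∑ i, m i) → A :=
  fun k => b (finSigmaFinEquiv.symm k).1 (finSigmaFinEquiv.symm k).2

theorem concat_apply {A : Type} {n : ℕ} {m : Fin n → ℕ} (b : ∀ i, Fin (m i) → A)
    (x : Σ i, Fin (m i)) : concat b (finSigmaFinEquiv x) = b x.1 x.2 := by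
  unfold concat
  rw [Equiv.symm_apply_apply]

/-- A bijection between two disjoint unions of finite ordinals, read as a bijection between
the sums of these ordinals. -/
def blockEquiv {n n' : ℕ} {m : Fin n → ℕ} {m' : Fin n' → ℕ}
    (e : (Σ i, Fin (m i)) ≃ Σ j, Fin (m' j)) : Fin (∑ i, m i) ≃ Fin (∑ j, m' j) :=
  finSigmaFinEquiv.symm.trans (e.trans finSigmaFinEquiv)

theorem concat_blockEquiv {A : Type} {n n' : ℕ} {m : Fin n → ℕ} {m' : Fin n' → ℕ}
    (e : (Σ i, Fin (m i)) ≃ Σ j, Fin (m' j)) (b : ∀ i, Fin (m i) → A)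
    (b' : ∀ j, Fin (m' j) → A) (h : ∀ x, b' (e x).1 (e x).2 = b x.1 x.2)
    (k : Fin (∑ i, m i)) : concat b' (blockEquiv e k) = concat b k := by
  obtain ⟨x, rfl⟩ := finSigmaFinEquiv.surjective k
  simp only [blockEquiv, Equiv.trans_apply, Equiv.symm_apply_apply, concat_apply, h]

/-- The bijection that identifies the two ways of bracketing an iterated sum of ordinals. -/
def assocEquiv {n : ℕ} {m : Fin n → ℕ} (l : ∀ i, Fin (m i) → ℕ) :
    Fin (∑ k, concat l k) ≃ Fin (∑ i, ∑ j, l i j) :=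
  blockEquiv (m := concat l) <|
    (Equiv.sigmaCongrLeft (β := fun x : Σ i, Fin (m i) => Fin (l x.1 x.2))
        finSigmaFinEquiv.symm).trans
      ((Equiv.sigmaAssoc fun i j => Fin (l i j)).trans
        (Equiv.sigmaCongrRight fun _ => finSigmaFinEquiv))

theorem concat_assocEquiv {A : Type} {n : ℕ} {m : Fin n → ℕ} (l : ∀ i, Fin (m i) → ℕ)
    (a : ∀ i j, Fin (l i j) → A) (k : Fin (∑ k, concat l k)) :
    concat (fun i => concat (a i)) (assocEquiv l k) =
      concat (fun k => a (finSigmaFinEquiv.symm k).1 (finSigmaFinEquiv.symm k).2) k :=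
  concat_blockEquiv (m := concat l) _
    (fun k => a (finSigmaFinEquiv.symm k).1 (finSigmaFinEquiv.symm k).2)
    (fun i => concat (a i)) (fun x => concat_apply (a (finSigmaFinEquiv.symm x.1).1)
      ⟨(finSigmaFinEquiv.symm x.1).2, x.2⟩) k

/-- A symmetric coloured operad. `Op c d` is the set `P(c_1, …, c_n; d)` of operations. The
symmetric group actions are given by the maps
`reindex σ : P(c_1, …, c_n; d) → P(c'_1, …, c'_n; d)`, for `c'_{σ i} = c_i`. -/
structure Operad where
  Color : Type
  Op : {n : ℕ} → (Fin n → Color) → Color → Type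
  reindex : ∀ {m n : ℕ} {c : Fin m → Color} {c' : Fin n → Color} {d : Color}
    (σ : Fin m ≃ Fin n), (∀ i, c' (σ i) = c i) → Op c d → Op c' d
  unit : ∀ c : Color, Op (fun _ : Fin 1 => c) c
  comp : ∀ {n : ℕ} {m : Fin n → ℕ} {c : Fin n → Color} {b : ∀ i, Fin (m i) → Color}
    {d : Color}, Op c d → (∀ i, Op (b i) (c i)) → Op (concat b) d
  reindex_refl : ∀ {n : ℕ} {c : Fin n → Color} {d : Color} (p : Op c d),
    reindex (Equiv.refl _) (fun _ => rfl) p = p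
  reindex_reindex : ∀ {l m n : ℕ} {c : Fin l → Color} {c' : Fin m → Color}
    {c'' : Fin n → Color} {d : Color} (σ : Fin l ≃ Fin m) (τ : Fin m ≃ Fin n)
    (h : ∀ i, c' (σ i) = c i) (h' : ∀ i, c'' (τ i) = c' i) (p : Op c d),
    reindex τ h' (reindex σ h p) =
      reindex (σ.trans τ) (fun i => (h' (σ i)).trans (h i)) p
  reindex_comp : ∀ {n n' : ℕ} {m : Fin n' → ℕ} {c : Fin n' → Color}
    {b : ∀ i, Fin (m i) → Color} {d : Color} (σ : Fin n ≃ Fin n')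
    (p : Op (fun i => c (σ i)) d) (q : ∀ i, Op (b i) (c i)),
    comp (reindex σ (fun _ => rfl) p) q =
      reindex (blockEquiv (Equiv.sigmaCongrLeft (β := fun i => Fin (m i)) σ))
        (concat_blockEquiv _ (fun i => b (σ i)) b fun _ => rfl) (comp p fun i => q (σ i))
  comp_reindex : ∀ {n : ℕ} {m m' : Fin n → ℕ} {c : Fin n → Color}
    {b : ∀ i, Fin (m i) → Color} {b' : ∀ i, Fin (m' i) → Color} {d : Color}
    (τ : ∀ i, Fin (m i) ≃ Fin (m' i)) (h : ∀ i j, b' i (τ i j) = b i j)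
    (p : Op c d) (q : ∀ i, Op (b i) (c i)),
    comp p (fun i => reindex (τ i) (h i) (q i)) =
      reindex (blockEquiv (Equiv.sigmaCongrRight τ))
        (concat_blockEquiv _ b b' fun x => h x.1 x.2) (comp p q)
  unit_comp : ∀ {n : ℕ} {c : Fin n → Color} {d : Color} (p : Op c d),
    comp (unit d) (fun _ => p) =
      reindex ((Equiv.uniqueSigma fun _ : Fin 1 => Fin n).symm.trans finSigmaFinEquiv)
        (fun i => concat_apply (fun _ : Fin 1 => c) ⟨0, i⟩) p
  comp_unit : ∀ {n : ℕ} {c : Fin n → Color} {d : Color} (p : Op c d),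
    comp p (fun i => unit (c i)) =
      reindex ((Equiv.sigmaUnique (Fin n) fun _ => Fin 1).symm.trans finSigmaFinEquiv)
        (fun i => concat_apply (fun (i : Fin n) (_ : Fin 1) => c i) ⟨i, 0⟩) p
  assoc : ∀ {n : ℕ} {m : Fin n → ℕ} {l : ∀ i, Fin (m i) → ℕ} {c : Fin n → Color}
    {b : ∀ i, Fin (m i) → Color} {a : ∀ i j, Fin (l i j) → Color} {d : Color}
    (p : Op c d) (q : ∀ i, Op (b i) (c i)) (r : ∀ i j, Op (a i j) (b i j)),
    comp p (fun i => comp (q i) (r i)) =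
      reindex (assocEquiv l) (concat_assocEquiv l a)
        (comp (comp p q) fun k => r (finSigmaFinEquiv.symm k).1 (finSigmaFinEquiv.symm k).2)

/-- Morphisms of symmetric coloured operads. -/
structure Operad.Hom (P Q : Operad) where
  color : P.Color → Q.Color
  op : ∀ {n : ℕ} {c : Fin n → P.Color} {d : P.Color},
    P.Op c d → Q.Op (fun i => color (c i)) (color d)
  map_reindex : ∀ {m n : ℕ} {c : Fin m → P.Color} {c' : Fin n → P.Color} {d : P.Color}
    (σ : Fin m ≃ Fin n) (h : ∀ i, c' (σ i) = c i) (p : P.Op c d),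
    op (P.reindex σ h p) = Q.reindex σ (fun i => congrArg color (h i)) (op p)
  map_unit : ∀ c : P.Color, op (P.unit c) = Q.unit (color c)
  map_comp : ∀ {n : ℕ} {m : Fin n → ℕ} {c : Fin n → P.Color}
    {b : ∀ i, Fin (m i) → P.Color} {d : P.Color} (p : P.Op c d)
    (q : ∀ i, P.Op (b i) (c i)),
    op (P.comp p q) = Q.comp (b := fun i j => color (b i j)) (op p) fun i => op (q i)

/-- The category of symmetric coloured operads. -/
instance : Category Operad where
  Hom := Operad.Hom
  id P :=
    { color := fun c => c
      op := fun p => p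
      map_reindex := fun _ _ _ => rfl
      map_unit := fun _ => rfl
      map_comp := fun _ _ => rfl }
  comp f g :=
    { color := fun c => g.color (f.color c)
      op := fun p => g.op (f.op p)
      map_reindex := fun σ h p => by rw [f.map_reindex, g.map_reindex]
      map_unit := fun c => by rw [f.map_unit, g.map_unit]
      map_comp := fun p q =>
        (congrArg g.op (f.map_comp p q)).trans (g.map_comp (f.op p) fun i => f.op (q i)) }

/-! ### Free operads -/

/-- A collection of generating operations. The inputs of a generator `g` are indexed by a finite
set `Arity g`, which carries no order. -/
structure Collection where
  Color : Type
  Gen : Type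
  Arity : Gen → Type
  arityFintype : ∀ g, Fintype (Arity g)
  source : ∀ g, Arity g → Color
  target : Gen → Color

attribute [instance] Collection.arityFintype

/-- Formal composites of generators of `K` with output colour `d`, in variables `x : X` of
colours `c x`. -/
inductive Term (K : Collection) {X : Type} (c : X → K.Color) : K.Color → Type
  | var (x : X) {d : K.Color} (h : c x = d) : Term K c d
  | node (g : K.Gen) (t : ∀ i : K.Arity g, Term K c (K.source g i)) : Term K c (K.target g)

namespace Term

variable {K : Collection} {X Y Z : Type} {c : X → K.Color} {b : Y → K.Color}
  {a : Z → K.Color} {d : K.Color}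

/-- The number of occurrences of the variable `x` in a formal composite. -/
def count [DecidableEq X] (x : X) : {d : K.Color} → Term K c d → ℕ
  | _, .var y _ => if y = x then 1 else 0
  | _, .node _ t => ∑ i, count x (t i)

/-- Simultaneous substitution of formal composites for the variables. -/
def subst (s : ∀ x, Term K b (c x)) : {d : K.Color} → Term K c d → Term K b d
  | _, .var x h => h ▸ s x
  | _, .node g t => .node g fun i => subst s (t i)

/-- Renaming of the variables. -/
def rename (f : X → Y) (h : ∀ x, b (f x) = c x) {d : K.Color} (t : Term K c d) :
    Term K b d :=
  t.subst fun x => .var (f x) (h x)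

theorem subst_var_self (t : Term K c d) : t.subst (fun x => .var x rfl) = t := by
  induction t with
  | var x h => subst h; rfl
  | node g t ih => simp only [subst, ih]

theorem subst_subst (s : ∀ x, Term K b (c x)) (r : ∀ y, Term K a (b y)) (t : Term K c d) :
    (t.subst s).subst r = t.subst fun x => (s x).subst r := by
  induction t with
  | var x h => subst h; rfl
  | node g t ih => simp only [subst, ih]

theorem cast_var {d d' : K.Color} (x : X) (h : c x = d) (e : d = d') :
    e ▸ (Term.var x h : Term K c d) = .var x (h.trans e) := by
  subst e; rfl

theorem subst_congr {s r : ∀ x, Term K b (c x)} (h : ∀ x, s x = r x) (t : Term K c d) :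
    t.subst s = t.subst r := by
  rw [funext h]

theorem rename_congr {f g : X → Y} (e : ∀ x, f x = g x) (hf : ∀ x, b (f x) = c x)
    (hg : ∀ x, b (g x) = c x) (t : Term K c d) : t.rename f hf = t.rename g hg := by
  obtain rfl : f = g := funext e
  rfl

theorem subst_rename (f : X → Y) (h : ∀ x, b (f x) = c x) (r : ∀ y, Term K a (b y))
    (t : Term K c d) : (t.rename f h).subst r = t.subst fun x => h x ▸ r (f x) :=
  subst_subst _ _ t

theorem rename_subst (s : ∀ x, Term K b (c x)) (f : Y → Z) (h : ∀ y, a (f y) = b y)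
    (t : Term K c d) : (t.subst s).rename f h = t.subst fun x => (s x).rename f h :=
  subst_subst _ _ t

theorem rename_rename (f : X → Y) (h : ∀ x, b (f x) = c x) (g : Y → Z)
    (h' : ∀ y, a (g y) = b y) (t : Term K c d) :
    (t.rename f h).rename g h' = t.rename (fun x => g (f x)) fun x => (h' _).trans (h x) :=
  (subst_subst _ _ t).trans (subst_congr (fun x => cast_var _ (h' _) (h x)) t)

theorem count_subst [DecidableEq X] [Fintype X] [DecidableEq Y] (s : ∀ x, Term K b (c x))
    (y : Y) (t : Term K c d) :
    (t.subst s).count y = ∑ x, t.count x * (s x).count y := by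
  induction t with
  | var x h => subst h; simp [subst, count]
  | node g t ih =>
    simp only [subst, count, ih, Finset.sum_mul]
    exact Finset.sum_comm

end Term

/-- The operations of the free symmetric operad on `K`: formal composites in which every variable
occurs exactly once. -/
def FreeOp (K : Collection) {n : ℕ} (c : Fin n → K.Color) (d : K.Color) : Type :=
  {t : Term K c d // ∀ x, t.count x = 1}

namespace FreeOp

variable {K : Collection}

/-- The action of a bijection on the inputs. -/
def reindex {m n : ℕ} {c : Fin m → K.Color} {c' : Fin n → K.Color} {d : K.Color}
    (σ : Fin m ≃ Fin n) (h : ∀ i, c' (σ i) = c i) (p : FreeOp K c d) : FreeOp K c' d :=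
  ⟨p.1.rename σ h, fun x => by
    obtain ⟨y, rfl⟩ := σ.surjective x
    simp [Term.rename, Term.count_subst, Term.count, p.2]⟩

/-- The unit operation. -/
def unit (c : K.Color) : FreeOp K (fun _ : Fin 1 => c) c :=
  ⟨.var 0 rfl, fun x => by simp [Term.count, Subsingleton.elim 0 x]⟩

/-- Composition of operations: substitution, with disjoint sets of variables. -/
def comp {n : ℕ} {m : Fin n → ℕ} {c : Fin n → K.Color} {b : ∀ i, Fin (m i) → K.Color}
    {d : K.Color} (p : FreeOp K c d) (q : ∀ i, FreeOp K (b i) (c i)) :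
    FreeOp K (concat b) d :=
  ⟨p.1.subst fun i =>
      (q i).1.rename (fun j => finSigmaFinEquiv ⟨i, j⟩) fun j => concat_apply b ⟨i, j⟩,
    fun x => by
      obtain ⟨⟨i, j⟩, rfl⟩ := finSigmaFinEquiv.surjective x
      simp only [Term.count_subst, Term.rename, p.2, (q _).2, Term.count, one_mul,
        EmbeddingLike.apply_eq_iff_eq]
      rw [Finset.sum_eq_single i, Finset.sum_eq_single j]
      · simp
      · intro j' _ hj
        simp [hj]
      · simp
      · intro i' _ hi
        simp [hi]
      · simp⟩

end FreeOp

/-- The free symmetric coloured operad on a collection. -/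
def freeOperad (K : Collection) : Operad where
  Color := K.Color
  Op := FreeOp K
  reindex := FreeOp.reindex
  unit := FreeOp.unit
  comp := FreeOp.comp
  reindex_refl p := Subtype.ext (Term.subst_var_self p.1)
  reindex_reindex σ τ h h' p := Subtype.ext (Term.rename_rename σ h τ h' p.1)
  reindex_comp σ p q := by
    apply Subtype.ext
    simp only [FreeOp.comp, FreeOp.reindex, Term.subst_rename, Term.rename_subst,
      Term.rename_rename]
    refine Term.subst_congr (fun i => Term.rename_congr (fun j => ?_) _ _ _) _
    simp [blockEquiv]
  comp_reindex τ h p q := by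
    apply Subtype.ext
    simp only [FreeOp.comp, FreeOp.reindex, Term.rename_subst, Term.rename_rename]
    refine Term.subst_congr (fun i => Term.rename_congr (fun j => ?_) _ _ _) _
    simp [blockEquiv]
  unit_comp p := Subtype.ext (Term.rename_congr (fun _ => rfl) _ _ p.1)
  comp_unit p := Subtype.ext (Term.subst_congr (fun _ => rfl) p.1)
  assoc {n m l c b a d} p q r := by
    apply Subtype.ext
    simp only [FreeOp.comp, FreeOp.reindex, Term.subst_subst, Term.subst_rename,
      Term.rename_subst, Term.rename_rename]
    have key : ∀ (k : Fin (∑ i, m i)) (y : Σ i, Fin (m i)) (_ : finSigmaFinEquiv.symm k = y)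
        (e : b (finSigmaFinEquiv.symm k).1 (finSigmaFinEquiv.symm k).2 = b y.1 y.2) h₁ h₂ h₃,
        Term.rename (fun z => finSigmaFinEquiv ⟨y.1, finSigmaFinEquiv ⟨y.2, z⟩⟩) h₁
            (r y.1 y.2).1 =
          Term.rename (b := concat fun i => concat (a i)) (assocEquiv l) h₂
            (e ▸ Term.rename
              (b := concat fun k => a (finSigmaFinEquiv.symm k).1 (finSigmaFinEquiv.symm k).2)
              (fun z => finSigmaFinEquiv (n := concat l) ⟨k, z⟩) h₃
              (r (finSigmaFinEquiv.symm k).1 (finSigmaFinEquiv.symm k).2).1) := by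
      rintro k _ rfl e h₁ h₂ h₃
      refine Eq.trans (Term.rename_congr (fun z => ?_) _ _ _)
        (Term.rename_rename _ h₃ _ h₂ _).symm
      exact congrArg (fun x => finSigmaFinEquiv (((Equiv.sigmaAssoc fun i j => Fin (l i j)).trans
        (Equiv.sigmaCongrRight fun _ => finSigmaFinEquiv))
          ((Equiv.sigmaCongrLeft (β := fun x : Σ i, Fin (m i) => Fin (l x.1 x.2))
            finSigmaFinEquiv.symm) x)))
        (Equiv.symm_apply_apply (finSigmaFinEquiv (n := concat l)) ⟨k, z⟩).symm
    refine Eq.trans ?_ (Term.rename_subst _ _ (concat_assocEquiv l a) _).symm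
    refine Term.subst_congr (fun i => ?_) _
    refine Eq.trans ?_ (Term.rename_subst _ _ (concat_assocEquiv l a) _).symm
    exact Term.subst_congr (fun j => key _ ⟨i, j⟩ (Equiv.symm_apply_apply _ _) _ _ _ _) _

/-! ### Trees -/

/-- A finite non-planar rooted tree. Every vertex has exactly one output edge, and every edge is
the output of at most one vertex (it is a leaf if it is the output of none). Every edge other than
the root is an input of exactly one vertex, the root is an input of none, and descending from any
edge through the vertices one reaches the root. -/
structure Tree where
  Edge : Type
  Vertex : Type
  finite_edge : Finite Edge
  root : Edge
  output : Vertex → Edge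
  output_injective : Function.Injective output
  /-- the vertex of which a non-root edge is an input -/
  below : {e : Edge // e ≠ root} → Vertex
  descend : ∀ e : Edge, Relation.ReflTransGen
    (fun e e' => ∃ h : e ≠ root, output (below ⟨e, h⟩) = e') e root

namespace Tree

attribute [instance] Tree.finite_edge

/-- The set of input edges of a vertex. -/
def Input (T : Tree) (w : T.Vertex) : Type :=
  {e : {e : T.Edge // e ≠ T.root} // T.below e = w}

noncomputable instance (T : Tree) (w : T.Vertex) : Fintype (T.Input w) :=
  @Fintype.ofFinite _ (inferInstanceAs (Finite (Subtype _)))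

/-- The collection whose colours are the edges of `T` and whose generators are the vertices of `T`,
each an operation from its input edges to its output edge. -/
noncomputable def collection (T : Tree) : Collection where
  Color := T.Edge
  Gen := T.Vertex
  Arity := T.Input
  arityFintype := inferInstance
  source _ i := i.1.1
  target := T.output

/-- The operad `Ω(T)` generated by a tree `T`. -/
noncomputable def operad (T : Tree) : Operad :=
  freeOperad T.collection

/-- The category `Ω` of trees: a morphism `S → T` is a morphism of operads `Ω(S) → Ω(T)`. -/
noncomputable instance : Category Tree where
  Hom S T := S.operad ⟶ T.operad
  id S := 𝟙 S.operad
  comp f g := f ≫ g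

end Tree

end Dendroidal

/-!
The category `Ω` is contracted by two natural transformations `id ⟶ F ⟵ const`. Here `F` is the
endofunctor `Dendroidal.Tree.closureFunctor`, which puts a vertex without inputs on top of every
leaf of a tree and a unary vertex with a new root edge below the old root. The first transformation
is the inclusion of a tree, and the second one is the inclusion of the new root, whose source is the
tree with a single edge.

That `F` is a functor rests on a description of the operads `Ω(T)` in terms of the order on the
edges of `T`. The inputs of an operation are pairwise incomparable edges above its output
(`le_of_count_ne_zero`, `eq_of_count_ne_zero_of_le`), and they determine the operation
(`subsingleton_freeOp`). If `T` has no leaves, then all such tuples of inputs occur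
(`nonempty_freeOp`). So a morphism into a tree without leaves is the same as a map on edges that
preserves the order and incomparability (`homOfEdgeMap`), and every morphism of trees has these two
properties (`hom_le`, `hom_incomparable`). They persist when a new root is added.

It remains to see that a natural transformation induces a homotopy between the realizations of
nerves. Its nerve is a simplicial homotopy `X ⊗ Δ[1] ⟶ Y`, so that one needs maps
`|Δ[n]| × [0, 1] → |Δ[n] ⊗ Δ[1]|` which are continuous and natural in `n`. The realization
`|Δ[n] ⊗ Δ[1]|` is compact, and it embeds into the simplex spanned by all pairs of vertices
(`prodRealizationWeight`), with image the weights that are supported on a chain. A point of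
`|Δ[n]| × [0, 1]` is a pair of probability distributions on linearly ordered sets, and the monotone
coupling of these is a weight of this kind (`coupling`). It is given by a continuous formula, and it
is natural since the coupling is characterized by its values on lower sets. So continuity and
naturality of the required maps (`prism`) follow from those of the coupling.

Finally, a contractible space has trivial homotopy groups at all base points
(`genLoop_homotopic_const`), so that every map between contractible spaces is a weak homotopy
equivalence.
-/

namespace Dendroidal

/-! ### Maps between contractible spaces -/

section Contractible

open scoped unitInterval Topology Topology.Homotopy

variable {X Y : Type*} [TopologicalSpace X] [TopologicalSpace Y]

/-- The map from the cube to itself that stretches the middle half of every coordinate to the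
whole interval. The parameter interpolates linearly with the identity. -/
noncomputable def stretch {n : ℕ} : C(I × (Fin n → I), Fin n → I) where
  toFun q i := Set.projIcc 0 1 zero_le_one ((1 + (q.1 : ℝ)) * ((q.2 i : ℝ) - 1 / 2) + 1 / 2)
  continuous_toFun := by
    refine continuous_pi fun i => continuous_projIcc.comp ?_
    fun_prop

theorem stretch_zero {n : ℕ} (y : Fin n → I) : stretch (0, y) = y := by
  funext i
  have : (1 + ((0 : I) : ℝ)) * ((y i : ℝ) - 1 / 2) + 1 / 2 = y i := by simp
  simp only [stretch, ContinuousMap.coe_mk, this, Set.projIcc_val]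

theorem stretch_mem_boundary {n : ℕ} (s : I) {y : Fin n → I} (i : Fin n)
    (h : (1 + (s : ℝ)) * |(y i : ℝ) - 1 / 2| ≥ 1 / 2) :
    stretch (s, y) ∈ Cube.boundary (Fin n) := by
  refine ⟨i, ?_⟩
  have hs := s.2.1
  simp only [stretch, ContinuousMap.coe_mk]
  rcases abs_cases ((y i : ℝ) - 1 / 2) with ⟨e, _⟩ | ⟨e, _⟩ <;> rw [e] at h
  · right
    exact Set.projIcc_of_right_le _ (by linarith)
  · left
    exact Set.projIcc_of_le_left _ (by linarith)

theorem stretch_boundary {n : ℕ} (s : I) {y : Fin n → I} (h : y ∈ Cube.boundary (Fin n)) :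
    stretch (s, y) ∈ Cube.boundary (Fin n) := by
  obtain ⟨i, hi⟩ := h
  apply stretch_mem_boundary s i
  have hs := s.2.1
  have : |(y i : ℝ) - 1 / 2| = 1 / 2 := by
    rcases hi with hi | hi <;> rw [hi] <;> norm_num [abs_of_nonneg, abs_of_nonpos]
  rw [this]
  linarith

/-- A function on the cube that vanishes on the boundary and equals `1` wherever all coordinates
lie in the middle half. -/
noncomputable def bump {n : ℕ} : C(Fin n → I, I) where
  toFun y := ∏ i, Set.projIcc 0 1 zero_le_one (2 - 4 * |(y i : ℝ) - 1 / 2|)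
  continuous_toFun := by
    refine continuous_finsetProd _ fun i _ => continuous_projIcc.comp ?_
    fun_prop

theorem bump_boundary {n : ℕ} {y : Fin n → I} (h : y ∈ Cube.boundary (Fin n)) : bump y = 0 := by
  obtain ⟨i, hi⟩ := h
  refine Finset.prod_eq_zero (Finset.mem_univ i) ?_
  have : |(y i : ℝ) - 1 / 2| = 1 / 2 := by
    rcases hi with hi | hi <;> rw [hi] <;> norm_num [abs_of_nonneg, abs_of_nonpos]
  rw [this]
  exact Set.projIcc_of_le_left _ (by norm_num)

theorem bump_eq_one {n : ℕ} {y : Fin n → I} (h : ∀ i, |(y i : ℝ) - 1 / 2| ≤ 1 / 4) :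
    bump y = 1 := by
  change ∏ i, Set.projIcc (0 : ℝ) 1 zero_le_one (2 - 4 * |(y i : ℝ) - 1 / 2|) = 1
  refine Finset.prod_eq_one fun i _ => ?_
  exact Set.projIcc_of_right_le _ (by linarith [h i])

theorem stretch_one_mem_boundary_or_bump_eq_one {n : ℕ} (y : Fin n → I) :
    stretch (1, y) ∈ Cube.boundary (Fin n) ∨ bump y = 1 := by
  by_cases h : ∀ i, |(y i : ℝ) - 1 / 2| ≤ 1 / 4
  · exact Or.inr (bump_eq_one h)
  · push Not at h
    obtain ⟨i, hi⟩ := h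
    refine Or.inl (stretch_mem_boundary 1 i ?_)
    norm_num
    norm_num at hi
    linarith

/-- In a contractible space every generalized loop is null-homotopic relative to the boundary of
the cube. A contraction moves the base point along a path `p`, so that it only gives a free
homotopy. To keep the boundary fixed, the loop is first stretched, which leaves a collar of the
boundary at the base point, and the contraction is then applied with a speed that decreases to `0`
along the collar. At the end the loop has become a path from the base point along `p` and can be
retracted along `p`. -/
theorem genLoop_homotopic_const [ContractibleSpace X] {n : ℕ} {x : X} (γ : Ω^ (Fin n) X x) :
    GenLoop.Homotopic γ GenLoop.const := by
  obtain ⟨x₀, ⟨H⟩⟩ := id_nullhomotopic X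
  have H0 (z : X) : H (0, z) = z := H.apply_zero z
  have H1 (z : X) : H (1, z) = x₀ := H.apply_one z
  have hγ : ∀ y ∈ Cube.boundary (Fin n), γ y = x := γ.2
  have e : ∀ y, H (bump y, γ (stretch (1, y))) = H (bump y, x) := fun y => by
    rcases stretch_one_mem_boundary_or_bump_eq_one y with h | h
    · rw [hγ _ h]
    · rw [h, H1, H1]
  have cγ : Continuous γ := γ.1.continuous
  let A : ContinuousMap.HomotopyRel γ.1
      ⟨fun y => γ (stretch (1, y)), by fun_prop⟩ (Cube.boundary (Fin n)) :=
    { toFun := fun q => γ (stretch q)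
      continuous_toFun := by fun_prop
      map_zero_left := fun y => congrArg γ (stretch_zero y)
      map_one_left := fun y => rfl
      prop' := fun s y hy => (hγ _ (stretch_boundary s hy)).trans (hγ y hy).symm }
  let B : ContinuousMap.HomotopyRel (⟨fun y => γ (stretch (1, y)), by fun_prop⟩ : C(Fin n → I, X))
      ⟨fun y => H (bump y, x), by fun_prop⟩ (Cube.boundary (Fin n)) :=
    { toFun := fun q => H (q.1 * bump q.2, γ (stretch (1, q.2)))
      continuous_toFun := by fun_prop
      map_zero_left := fun y => by simp only [zero_mul, H0, ContinuousMap.coe_mk]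
      map_one_left := fun y => by
        simp only [one_mul]
        exact e y
      prop' := fun s y hy => by
        simp only [bump_boundary hy, mul_zero, H0, ContinuousMap.coe_mk] }
  let C : ContinuousMap.HomotopyRel (ContinuousMap.const _ x)
      (⟨fun y => H (bump y, x), by fun_prop⟩ : C(Fin n → I, X)) (Cube.boundary (Fin n)) :=
    { toFun := fun q => H (q.1 * bump q.2, x)
      continuous_toFun := by fun_prop
      map_zero_left := fun y => by simp only [zero_mul, H0, ContinuousMap.const_apply]
      map_one_left := fun y => by simp only [one_mul, ContinuousMap.coe_mk]
      prop' := fun s y hy => by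
        change H (s * bump y, x) = x
        rw [bump_boundary hy, mul_zero, H0] }
  exact ⟨(A.trans B).trans C.symm⟩

theorem subsingleton_homotopyGroup [ContractibleSpace X] (n : ℕ) (x : X) :
    Subsingleton (π_ n X x) := by
  refine ⟨fun a b => ?_⟩
  induction a using Quotient.inductionOn
  induction b using Quotient.inductionOn
  exact Quotient.sound ((genLoop_homotopic_const _).trans (genLoop_homotopic_const _).symm)

theorem subsingleton_zerothHomotopy [PathConnectedSpace X] : Subsingleton (ZerothHomotopy X) := by
  refine ⟨fun a b => ?_⟩
  induction a using Quotient.inductionOn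
  induction b using Quotient.inductionOn
  exact Quotient.sound (PathConnectedSpace.joined _ _)

/-- Every continuous map between contractible spaces is a weak homotopy equivalence. -/
theorem isWeakHomotopyEquiv_of_contractible [ContractibleSpace X] [ContractibleSpace Y]
    (f : C(X, Y)) : IsWeakHomotopyEquiv f := by
  have bij {A B : Type _} (g : A → B) [Subsingleton A] [Subsingleton B] [Nonempty A] :
      Function.Bijective g :=
    ⟨Function.injective_of_subsingleton g,
      fun b => ⟨Classical.arbitrary A, Subsingleton.elim _ _⟩⟩
  constructor
  · have := subsingleton_zerothHomotopy (X := X)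
    have := subsingleton_zerothHomotopy (X := Y)
    have : Nonempty (ZerothHomotopy X) := ⟨Quotient.mk _ (Classical.arbitrary X)⟩
    exact bij _
  · intro n _ x
    have := subsingleton_homotopyGroup n x
    have := subsingleton_homotopyGroup n (f x)
    have : Nonempty (π_ n X x) := ⟨Quotient.mk _ GenLoop.const⟩
    exact bij _

end Contractible

section Realization

open Simplicial Opposite MonoidalCategory
open scoped unitInterval

universe w

/-! ### Points of the geometric realization -/

/-- The point of the realization of `X` that lies in the simplex `x` at the barycentric
coordinates `t`. -/
noncomputable def realizationPoint {X : SSet.{w}} {n : SimplexCategory} (x : X.obj (op n)) :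
    C(stdSimplex ℝ (Fin (n.len + 1)), |X|) :=
  TopCat.toSSetObjEquiv _ (op n) ((sSetTopAdj.unit.app X).app (op n) x)

theorem realizationPoint_map {X : SSet.{w}} {m n : SimplexCategory} (f : m ⟶ n)
    (x : X.obj (op n)) (t : stdSimplex ℝ (Fin (m.len + 1))) :
    realizationPoint (X.map f.op x) t =
      realizationPoint x (stdSimplex.map f.toOrderHom t) := by
  have h := ConcreteCategory.congr_hom ((sSetTopAdj.unit.app X).naturality f.op) x
  exact congrArg (fun z => TopCat.toSSetObjEquiv _ (op m) z t) h

theorem toTop_map_realizationPoint {X Y : SSet.{w}} (g : X ⟶ Y) {n : SimplexCategory}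
    (x : X.obj (op n)) (t : stdSimplex ℝ (Fin (n.len + 1))) :
    (SSet.toTop.map g).hom (realizationPoint x t) = realizationPoint (g.app _ x) t := by
  have h := ConcreteCategory.congr_hom (NatTrans.congr_app (sSetTopAdj.unit.naturality g) (op n)) x
  unfold realizationPoint
  exact (congrArg (fun z => TopCat.toSSetObjEquiv _ (op n) z t) h).symm

/-- A compatible family of continuous maps out of the simplices of `X` defines a continuous map
out of the realization. -/
theorem exists_realization_desc {X : SSet.{w}} {Z : Type w} [TopologicalSpace Z]
    (φ : ∀ n : SimplexCategory, X.obj (op n) → C(stdSimplex ℝ (Fin (n.len + 1)), Z))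
    (hφ : ∀ {m n : SimplexCategory} (f : m ⟶ n) (x : X.obj (op n))
      (t : stdSimplex ℝ (Fin (m.len + 1))),
      φ m (X.map f.op x) t = φ n x (stdSimplex.map f.toOrderHom t)) :
    ∃ F : C(|X|, Z), ∀ (n : SimplexCategory) (x : X.obj (op n))
      (t : stdSimplex ℝ (Fin (n.len + 1))),
      F (realizationPoint x t) = φ n x t := by
  let ψ : X ⟶ TopCat.toSSet.obj (TopCat.of Z) :=
    { app n := ↾fun x => (TopCat.toSSetObjEquiv (TopCat.of Z) n).symm (φ n.unop x)
      naturality := fun n m f => by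
        ext x
        apply (TopCat.toSSetObjEquiv (TopCat.of Z) m).injective
        ext t
        exact hφ f.unop x t }
  refine ⟨((sSetTopAdj.homEquiv _ _).symm ψ).hom, fun n x t => ?_⟩
  have h := (sSetTopAdj.homEquiv X (TopCat.of Z)).apply_symm_apply ψ
  rw [Adjunction.homEquiv_unit] at h
  have h' := ConcreteCategory.congr_hom (NatTrans.congr_app h (op n)) x
  have h'' := congrArg (fun z => TopCat.toSSetObjEquiv (TopCat.of Z) (op n) z t) h'
  refine Eq.trans ?_ (h''.trans ?_)
  · rfl
  · exact DFunLike.congr_fun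
      ((TopCat.toSSetObjEquiv (TopCat.of Z) (op n)).apply_symm_apply (φ n x)) t

theorem realization_hom_ext {X : SSet.{w}} {Z : Type w} [TopologicalSpace Z] {F G : C(|X|, Z)}
    (h : ∀ (n : SimplexCategory) (x : X.obj (op n)) (t : stdSimplex ℝ (Fin (n.len + 1))),
      F (realizationPoint x t) = G (realizationPoint x t)) : F = G := by
  have : TopCat.ofHom F = TopCat.ofHom G := by
    apply (sSetTopAdj.homEquiv X (TopCat.of Z)).injective
    rw [Adjunction.homEquiv_unit, Adjunction.homEquiv_unit]
    ext n x
    apply (TopCat.toSSetObjEquiv (TopCat.of Z) n).injective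
    ext t
    exact h n.unop x t
  exact congrArg TopCat.Hom.hom this

/-- Every point of the realization lies in a simplex. -/
theorem exists_realizationPoint_eq {X : SSet.{w}} (z : |X|) :
    ∃ (n : ℕ) (x : X.obj (op ⦋n⦌)) (t : stdSimplex ℝ (Fin (n + 1))),
      realizationPoint x t = z := by
  -- Every map to an indiscrete space is continuous, so the characteristic function of the set of
  -- all points of the required form is determined by its values at these points.
  let A : |X| → Prop := fun z => ∃ (n : SimplexCategory) (x : X.obj (op n))
    (t : stdSimplex ℝ (Fin (n.len + 1))),
    realizationPoint x t = z
  let _ : TopologicalSpace (ULift.{w} Prop) := ⊤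
  let F : C(|X|, ULift.{w} Prop) := ⟨fun z => ⟨A z⟩, continuous_top⟩
  let G : C(|X|, ULift.{w} Prop) := ⟨fun _ => ⟨True⟩, continuous_top⟩
  have h : F = G := realization_hom_ext fun n x t =>
    ULift.ext _ _ (eq_true (⟨n, x, t, rfl⟩ : A _))
  obtain ⟨n, x, t, e⟩ : A z :=
    of_eq_true (congrArg ULift.down (DFunLike.congr_fun h z) : A z = True)
  exact ⟨n.len, x, t, e⟩

/-! ### The realization of a product of simplices -/

theorem stdSimplex_map_apply {A B : Type*} [Fintype A] [Fintype B] [DecidableEq B] (f : A → B)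
    (t : stdSimplex ℝ A) (b : B) : stdSimplex.map f t b = ∑ a with f a = b, t a := by
  rw [stdSimplex.map_coe, FunOnFinite.linearMap_apply_apply]

theorem stdSimplex_map_apply_of_injective {A B : Type*} [Fintype A] [Fintype B] {f : A → B}
    (hf : Function.Injective f) (t : stdSimplex ℝ A) (a : A) :
    stdSimplex.map f t (f a) = t a := by
  classical
  rw [stdSimplex_map_apply, Finset.sum_eq_single a]
  · intro b hb hne
    exact absurd (hf (Finset.mem_filter.1 hb).2) hne
  · simp

theorem stdSimplex_map_apply_of_notMem_range {A B : Type*} [Fintype A] [Fintype B] {f : A → B}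
    (t : stdSimplex ℝ A) {b : B} (hb : b ∉ Set.range f) : stdSimplex.map f t b = 0 := by
  classical
  rw [stdSimplex_map_apply, Finset.sum_eq_zero]
  intro a ha
  exact absurd ⟨a, (Finset.mem_filter.1 ha).2⟩ hb

/-- A point of a simplex whose coordinates vanish outside the range of an injective map comes
from the corresponding face. -/
theorem exists_stdSimplex_map_eq {A B : Type*} [Fintype A] [Fintype B] {f : A → B}
    (hf : Function.Injective f) (t : stdSimplex ℝ B) (ht : ∀ b, b ∉ Set.range f → t b = 0) :
    ∃ s : stdSimplex ℝ A, stdSimplex.map f s = t := by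
  classical
  let s : stdSimplex ℝ A := ⟨fun a => t (f a), fun a => t.2.1 _, by
    rw [← t.2.2]
    exact Finset.sum_of_injOn f hf.injOn (fun _ _ => Finset.mem_coe.2 (Finset.mem_univ _))
      (fun b _ hb => ht b fun ⟨a, ha⟩ => hb ⟨a, Finset.mem_coe.2 (Finset.mem_univ a), ha⟩)
      fun _ _ => rfl⟩
  refine ⟨s, ?_⟩
  ext b
  by_cases hb : b ∈ Set.range f
  · obtain ⟨a, rfl⟩ := hb
    exact stdSimplex_map_apply_of_injective hf s a
  · rw [stdSimplex_map_apply_of_notMem_range s hb, ht b hb]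

section Embedding

variable {p q : ℕ}

/-- Every point of `|Δ[p] ⊗ Δ[q]|` lies in the interior of a nondegenerate simplex. -/
theorem exists_injective_pos_realizationPoint_eq (z : |(Δ[p] ⊗ Δ[q] : SSet.{w})|) :
    ∃ (n : ℕ) (x : (Δ[p] ⊗ Δ[q] : SSet.{w}) _⦋n⦌) (t : stdSimplex ℝ (Fin (n + 1))),
      Function.Injective (SSet.prodStdSimplex.objEquiv x) ∧ (∀ i, 0 < t i) ∧
        realizationPoint x t = z := by
  classical
  have ex : ∃ n, ∃ (x : (Δ[p] ⊗ Δ[q] : SSet.{w}) _⦋n⦌) (t : stdSimplex ℝ (Fin (n + 1))),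
      realizationPoint x t = z := exists_realizationPoint_eq z
  -- A simplex of minimal dimension among those containing the point has the required properties.
  obtain ⟨x, t, e⟩ := Nat.find_spec ex
  have hmin := fun m => Nat.find_min ex (m := m)
  generalize Nat.find ex = n at x t e hmin
  refine ⟨n, x, t, ?_, fun i => ?_, e⟩
  · rw [← SSet.prodStdSimplex.nonDegenerate_iff_injective_objEquiv]
    rintro ⟨m, hm, f, y, rfl⟩
    exact hmin m hm ⟨y, _, (realizationPoint_map f y t).symm.trans e⟩
  · by_contra hi
    have hi0 : t i = 0 := le_antisymm (not_lt.1 hi) (t.2.1 i)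
    cases n with
    | zero =>
      have h1 : t 0 = 1 := (Fin.sum_univ_one _).symm.trans t.2.2
      rw [Fin.fin_one_eq_zero i, h1] at hi0
      exact one_ne_zero hi0
    | succ n =>
      obtain ⟨s, hs⟩ := exists_stdSimplex_map_eq (Fin.succAbove_right_injective (p := i)) t
        fun j hj => by
          rw [Fin.range_succAbove, Set.notMem_compl_iff, Set.mem_singleton_iff] at hj
          rw [hj, hi0]
      refine hmin n n.lt_succ_self ⟨(Δ[p] ⊗ Δ[q] : SSet.{w}).map (SimplexCategory.δ i).op x, s, ?_⟩
      rw [realizationPoint_map]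
      exact (congrArg (realizationPoint x) hs).trans e

/-- The weights of the vertices are compatible with the simplicial structure. The target is lifted
to the universe of the simplicial sets. -/
theorem exists_prodRealizationWeight (p q : ℕ) :
    ∃ F : C(|(Δ[p] ⊗ Δ[q] : SSet.{w})|, ULift.{w} (stdSimplex ℝ (Fin (p + 1) × Fin (q + 1)))),
      ∀ (n : SimplexCategory) (x : (Δ[p] ⊗ Δ[q] : SSet.{w}).obj (op n))
        (t : stdSimplex ℝ (Fin (n.len + 1))),
        F (realizationPoint x t) =
          ⟨stdSimplex.map (SSet.prodStdSimplex.objEquiv (n := n.len) x) t⟩ :=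
  exists_realization_desc
    (fun n x => ⟨fun t => ⟨stdSimplex.map (SSet.prodStdSimplex.objEquiv (n := n.len) x) t⟩,
      continuous_uliftUp.comp (stdSimplex.continuous_map _)⟩)
    fun f x t => ULift.ext _ _ (stdSimplex.map_comp_apply f.toOrderHom
      (SSet.prodStdSimplex.objEquiv x) t).symm

/-- The map from the realization of `Δ[p] ⊗ Δ[q]` to the simplex whose vertices are the pairs of
vertices of `Δ[p]` and `Δ[q]`. It is affine on every simplex and sends a vertex to itself. -/
noncomputable def prodRealizationWeight (p q : ℕ) :
    C(|(Δ[p] ⊗ Δ[q] : SSet.{w})|, stdSimplex ℝ (Fin (p + 1) × Fin (q + 1))) :=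
  ⟨fun z => ((exists_prodRealizationWeight p q).choose z).down,
    continuous_uliftDown.comp (exists_prodRealizationWeight p q).choose.continuous⟩

theorem prodRealizationWeight_realizationPoint {n : ℕ} (x : (Δ[p] ⊗ Δ[q] : SSet.{w}) _⦋n⦌)
    (t : stdSimplex ℝ (Fin (n + 1))) :
    prodRealizationWeight p q (realizationPoint x t) =
      stdSimplex.map (SSet.prodStdSimplex.objEquiv x) t :=
  congrArg ULift.down ((exists_prodRealizationWeight p q).choose_spec ⦋n⦌ x t)

/-- A point in the interior of a nondegenerate simplex is recovered from its weights: their support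
is the chain of vertices of the simplex, and their values are the barycentric coordinates. -/
theorem prodRealizationWeight_injective :
    Function.Injective (prodRealizationWeight.{w} p q) := by
  intro z z' h
  obtain ⟨n, x, t, hx, ht, rfl⟩ := exists_injective_pos_realizationPoint_eq z
  obtain ⟨m, y, s, hy, hs, rfl⟩ := exists_injective_pos_realizationPoint_eq z'
  rw [prodRealizationWeight_realizationPoint, prodRealizationWeight_realizationPoint] at h
  -- The vertices of the carrying simplex are the pairs of positive weight.
  have supp {k : ℕ} (u : (Δ[p] ⊗ Δ[q] : SSet.{w}) _⦋k⦌) (r : stdSimplex ℝ (Fin (k + 1)))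
      (hu : Function.Injective (SSet.prodStdSimplex.objEquiv u)) (hr : ∀ i, 0 < r i) :
      Set.range (SSet.prodStdSimplex.objEquiv u) =
        {a | stdSimplex.map (SSet.prodStdSimplex.objEquiv u) r a ≠ 0} := by
    ext a
    constructor
    · rintro ⟨i, rfl⟩
      change stdSimplex.map _ r _ ≠ 0
      rw [stdSimplex_map_apply_of_injective hu]
      exact (hr i).ne'
    · exact fun ha => by_contra fun hb => ha (stdSimplex_map_apply_of_notMem_range r hb)
  have hr : Set.range (SSet.prodStdSimplex.objEquiv x) =
      Set.range (SSet.prodStdSimplex.objEquiv y) := by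
    rw [supp x t hx ht, supp y s hy hs, h]
  have hnm : n = m := by
    have := congrArg Set.ncard hr
    rw [← Set.image_univ, ← Set.image_univ, Set.ncard_image_of_injective _ hx,
      Set.ncard_image_of_injective _ hy] at this
    simpa using this
  subst hnm
  have hxy : x = y := by
    apply SSet.prodStdSimplex.objEquiv.injective
    apply DFunLike.coe_injective
    exact (StrictMono.range_inj
      ((SSet.prodStdSimplex.objEquiv x).monotone.strictMono_of_injective hx)
      ((SSet.prodStdSimplex.objEquiv y).monotone.strictMono_of_injective hy)).1 hr
  subst hxy
  congr 1
  ext i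
  rw [← stdSimplex_map_apply_of_injective hx t i, h, stdSimplex_map_apply_of_injective hx]

instance : CompactSpace |(Δ[p] ⊗ Δ[q] : SSet.{w})| := by
  -- The nondegenerate simplices form a finite family of compact spaces that covers.
  let N := Fintype.card (Fin (p + 1) × Fin (q + 1))
  let S := Σ (n : Fin N) (_ : (Δ[p] ⊗ Δ[q] : SSet.{w}) _⦋n.1⦌), stdSimplex ℝ (Fin (n.1 + 1))
  have (n : ℕ) : Finite ((Δ[p] ⊗ Δ[q] : SSet.{w}) _⦋n⦌) :=
    have : Finite (Fin (n + 1) →o Fin (p + 1) × Fin (q + 1)) :=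
      Finite.of_injective _ DFunLike.coe_injective
    Finite.of_equiv _ SSet.prodStdSimplex.objEquiv.symm
  let F : S → |(Δ[p] ⊗ Δ[q] : SSet.{w})| := fun y => realizationPoint y.2.1 y.2.2
  have hF : Continuous F := by
    refine continuous_sigma fun n => continuous_sigma fun x => ?_
    exact (realizationPoint x).continuous
  have hs : Function.Surjective F := by
    intro z
    obtain ⟨n, x, t, hx, ht, rfl⟩ := exists_injective_pos_realizationPoint_eq z
    have hn : n < N := by
      have := Fintype.card_le_of_injective _ hx
      rw [Fintype.card_fin] at this
      exact this
    exact ⟨⟨⟨n, hn⟩, x, t⟩, rfl⟩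
  exact ⟨by rw [← hs.range_eq]; exact isCompact_range hF⟩

theorem isClosedEmbedding_prodRealizationWeight :
    Topology.IsClosedEmbedding (prodRealizationWeight.{w} p q) :=
  (prodRealizationWeight p q).continuous.isClosedEmbedding prodRealizationWeight_injective

/-- A weight on the pairs of vertices whose support is a chain comes from a point of the
realization. -/
theorem mem_range_prodRealizationWeight (μ : stdSimplex ℝ (Fin (p + 1) × Fin (q + 1)))
    (h : ∀ a b, μ a ≠ 0 → μ b ≠ 0 → a ≤ b ∨ b ≤ a) :
    μ ∈ Set.range (prodRealizationWeight.{w} p q) := by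
  classical
  let S := {a : Fin (p + 1) × Fin (q + 1) // μ a ≠ 0}
  let _ : LinearOrder S :=
    { (inferInstance : PartialOrder S) with
      le_total := fun a b => h a.1 b.1 a.2 b.2
      toDecidableLE := Classical.decRel _ }
  have hS : Nonempty S := by
    by_contra hne
    have : ∀ a, μ a = 0 := fun a => by_contra fun ha => hne ⟨⟨a, ha⟩⟩
    exact zero_ne_one ((Finset.sum_eq_zero fun a _ => this a).symm.trans μ.2.2)
  obtain ⟨n, hn⟩ : ∃ n, Fintype.card S = n + 1 :=
    Nat.exists_eq_succ_of_ne_zero Fintype.card_ne_zero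
  let e := monoEquivOfFin S hn
  let f : Fin (n + 1) →o Fin (p + 1) × Fin (q + 1) :=
    ⟨fun i => (e i).1, fun i j hij => e.monotone hij⟩
  have hf : Function.Injective f := Subtype.val_injective.comp e.injective
  obtain ⟨t, ht⟩ := exists_stdSimplex_map_eq hf μ fun a ha => by
    by_contra ha'
    exact ha ⟨e.symm ⟨a, ha'⟩, congrArg Subtype.val (e.apply_symm_apply ⟨a, ha'⟩)⟩
  refine ⟨realizationPoint (SSet.prodStdSimplex.objEquiv.symm f) t, ?_⟩
  rw [prodRealizationWeight_realizationPoint, Equiv.apply_symm_apply, ht]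

end Embedding

/-! ### Monotone couplings and the prism -/

section Coupling

variable {n m : ℕ}

/-- Lay the coordinates of `t` out as consecutive intervals that fill `[0, 1]`. This is the length
of the part of the `i`-th interval that lies below `s`. -/
noncomputable def lowerPart (t : stdSimplex ℝ (Fin (n + 1))) (s : I) (i : Fin (n + 1)) : ℝ :=
  min (∑ k with k ≤ i, t k) s - min (∑ k with k < i, t k) s

theorem sum_le_eq (t : stdSimplex ℝ (Fin (n + 1))) (i : Fin (n + 1)) :
    ∑ k with k ≤ i, t k = t i + ∑ k with k < i, t k := by
  have h : (Finset.univ.filter fun k => k ≤ i) = insert i (Finset.univ.filter fun k => k < i) := by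
    ext k
    simp [le_iff_eq_or_lt]
  rw [h, Finset.sum_insert (by simp)]

theorem lowerPart_nonneg (t : stdSimplex ℝ (Fin (n + 1))) (s : I) (i : Fin (n + 1)) :
    0 ≤ lowerPart t s i := by
  have := t.2.1 i
  have h : 0 ≤ t i := this
  rw [lowerPart, sum_le_eq, sub_nonneg]
  exact min_le_min (by linarith) le_rfl

theorem lowerPart_le (t : stdSimplex ℝ (Fin (n + 1))) (s : I) (i : Fin (n + 1)) :
    lowerPart t s i ≤ t i := by
  have := t.2.1 i
  have h : 0 ≤ t i := this
  rw [lowerPart, sum_le_eq]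
  rcases min_cases (∑ k with k < i, t k) (s : ℝ) with ⟨e, _⟩ | ⟨e, _⟩ <;> rw [e]
  · linarith [min_le_left (t i + ∑ k with k < i, t k) (s : ℝ)]
  · linarith [min_le_right (t i + ∑ k with k < i, t k) (s : ℝ)]

theorem lowerPart_zero (t : stdSimplex ℝ (Fin (n + 1))) (i : Fin (n + 1)) :
    lowerPart t 0 i = 0 := by
  have h (k) : 0 ≤ t k := t.2.1 k
  rw [lowerPart, Set.Icc.coe_zero, min_eq_right (Finset.sum_nonneg fun k _ => h k),
    min_eq_right (Finset.sum_nonneg fun k _ => h k), sub_zero]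

theorem lowerPart_one (t : stdSimplex ℝ (Fin (n + 1))) (i : Fin (n + 1)) :
    lowerPart t 1 i = t i := by
  have h (k) : 0 ≤ t k := t.2.1 k
  have h1 (S : Finset (Fin (n + 1))) : ∑ k ∈ S, t k ≤ 1 :=
    (Finset.sum_le_univ_sum_of_nonneg h).trans t.2.2.le
  rw [lowerPart, Set.Icc.coe_one, min_eq_left (h1 _), min_eq_left (h1 _), sum_le_eq]
  ring

/-- The coordinates in a lower set fill an initial segment of `[0, 1]`. -/
theorem sum_lowerPart (t : stdSimplex ℝ (Fin (n + 1))) (s : I) (S : Finset (Fin (n + 1)))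
    (hS : ∀ i ∈ S, ∀ j ≤ i, j ∈ S) :
    ∑ i ∈ S, lowerPart t s i = min (∑ i ∈ S, t i) s := by
  induction S using Finset.induction_on_max with
  | empty => simp [s.2.1]
  | insert a S ha ih =>
    have haS : a ∉ S := fun h => lt_irrefl _ (ha a h)
    have hlt : (Finset.univ.filter fun k => k < a) = S := by
      ext k
      rw [Finset.mem_filter]
      refine ⟨fun hk => ?_, fun hk => ⟨Finset.mem_univ _, ha k hk⟩⟩
      exact (Finset.mem_insert.1 (hS a (Finset.mem_insert_self a S) k hk.2.le)).resolve_left hk.2.ne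
    have hle : ∑ k with k ≤ a, t k = ∑ i ∈ insert a S, t i := by
      rw [sum_le_eq, hlt, Finset.sum_insert haS]
    rw [Finset.sum_insert haS, ih, lowerPart, hle, hlt]
    · ring
    · intro i hi j hj
      refine (Finset.mem_insert.1 (hS i (Finset.mem_insert_of_mem hi) j hj)).resolve_left ?_
      rintro rfl
      exact absurd (ha i hi) (not_lt.2 hj)

theorem lowerPart_map (f : Fin (n + 1) →o Fin (m + 1)) (t : stdSimplex ℝ (Fin (n + 1))) (s : I)
    (j : Fin (m + 1)) :
    lowerPart (stdSimplex.map f t) s j = ∑ i with f i = j, lowerPart t s i := by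
  have hsum (Q : Fin (m + 1) → Prop) [DecidablePred Q] (g : Fin (n + 1) → ℝ) :
      ∑ k with Q k, ∑ i with f i = k, g i = ∑ i with Q (f i), g i := by
    rw [Finset.sum_fiberwise_eq_sum_filter]
    simp
  have hsplit : ∑ i with f i ≤ j, lowerPart t s i =
      ∑ i with f i = j, lowerPart t s i + ∑ i with f i < j, lowerPart t s i := by
    rw [← Finset.sum_union]
    · congr 1
      ext i
      simp [le_iff_eq_or_lt]
    · rw [Finset.disjoint_filter]
      intro i _ h
      exact fun h' => h'.ne h
  have hle := sum_lowerPart t s (Finset.univ.filter fun i => f i ≤ j) fun i hi k hk => by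
    simp only [Finset.mem_filter, Finset.mem_univ, true_and] at hi ⊢
    exact (f.monotone hk).trans hi
  have hlt := sum_lowerPart t s (Finset.univ.filter fun i => f i < j) fun i hi k hk => by
    simp only [Finset.mem_filter, Finset.mem_univ, true_and] at hi ⊢
    exact (f.monotone hk).trans_lt hi
  rw [lowerPart]
  simp only [stdSimplex_map_apply, hsum]
  rw [← hle, ← hlt, hsplit]
  ring

/-- The monotone coupling of the distribution `t` on the vertices of `Δ[n]` with the distribution
`(s, 1 - s)` on the vertices of `Δ[1]`. -/
noncomputable def coupling (t : stdSimplex ℝ (Fin (n + 1))) (s : I) :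
    stdSimplex ℝ (Fin (n + 1) × Fin (1 + 1)) :=
  ⟨fun a => if a.2 = 0 then lowerPart t s a.1 else t a.1 - lowerPart t s a.1, by
    constructor
    · intro a
      dsimp only
      split_ifs
      · exact lowerPart_nonneg t s _
      · exact sub_nonneg.2 (lowerPart_le t s _)
    · rw [Fintype.sum_prod_type]
      simp⟩

theorem coupling_apply (t : stdSimplex ℝ (Fin (n + 1))) (s : I) (a : Fin (n + 1) × Fin (1 + 1)) :
    coupling t s a = if a.2 = 0 then lowerPart t s a.1 else t a.1 - lowerPart t s a.1 :=
  rfl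

theorem continuous_coupling :
    Continuous fun q : stdSimplex ℝ (Fin (n + 1)) × I => coupling q.1 q.2 := by
  have h (k : Fin (n + 1)) : Continuous fun q : stdSimplex ℝ (Fin (n + 1)) × I => q.1 k :=
    (continuous_apply k).comp (continuous_subtype_val.comp continuous_fst)
  have hl (i : Fin (n + 1)) :
      Continuous fun q : stdSimplex ℝ (Fin (n + 1)) × I => lowerPart q.1 q.2 i := by
    unfold lowerPart
    fun_prop
  refine Continuous.subtype_mk (continuous_pi fun a => ?_) _
  split_ifs
  · exact hl _
  · exact (h _).sub (hl _)

theorem coupling_map (f : Fin (n + 1) →o Fin (m + 1)) (t : stdSimplex ℝ (Fin (n + 1))) (s : I) :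
    coupling (stdSimplex.map f t) s = stdSimplex.map (Prod.map f id) (coupling t s) := by
  ext ⟨j, ε⟩
  have h (g : Fin (n + 1) × Fin (1 + 1) → ℝ) :
      ∑ a with Prod.map f id a = (j, ε), g a = ∑ i with f i = j, g (i, ε) := by
    simp only [Finset.sum_filter]
    rw [Fintype.sum_prod_type]
    refine Finset.sum_congr rfl fun i _ => ?_
    rw [Finset.sum_eq_single ε]
    · simp
    · intro b _ hb
      simp [hb]
    · simp
  rw [stdSimplex_map_apply, h]
  simp only [coupling_apply]
  split_ifs
  · exact lowerPart_map f t s j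
  · rw [lowerPart_map, stdSimplex_map_apply, Finset.sum_sub_distrib]

theorem coupling_zero (t : stdSimplex ℝ (Fin (n + 1))) :
    coupling t 0 = stdSimplex.map (fun i => (i, 1)) t := by
  ext ⟨i, ε⟩
  rw [coupling_apply, lowerPart_zero, sub_zero]
  split_ifs with h
  · rw [stdSimplex_map_apply_of_notMem_range]
    rintro ⟨k, hk⟩
    rw [Prod.ext_iff] at hk
    exact one_ne_zero (hk.2.trans h)
  · obtain rfl : ε = 1 := Fin.eq_one_of_ne_zero ε h
    exact (stdSimplex_map_apply_of_injective (Prod.mk_left_injective _) t i).symm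

theorem coupling_one (t : stdSimplex ℝ (Fin (n + 1))) :
    coupling t 1 = stdSimplex.map (fun i => (i, 0)) t := by
  ext ⟨i, ε⟩
  rw [coupling_apply, lowerPart_one, sub_self]
  split_ifs with h
  · obtain rfl : ε = 0 := h
    exact (stdSimplex_map_apply_of_injective (Prod.mk_left_injective _) t i).symm
  · rw [stdSimplex_map_apply_of_notMem_range]
    rintro ⟨k, hk⟩
    rw [Prod.ext_iff] at hk
    exact h hk.2.symm

theorem coupling_chain (t : stdSimplex ℝ (Fin (n + 1))) (s : I)
    (a b : Fin (n + 1) × Fin (1 + 1)) (ha : coupling t s a ≠ 0) (hb : coupling t s b ≠ 0) :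
    a ≤ b ∨ b ≤ a := by
  have h (k) : 0 ≤ t k := t.2.1 k
  have key (i j : Fin (n + 1)) (hi : coupling t s (i, 0) ≠ 0) (hj : coupling t s (j, 1) ≠ 0) :
      i ≤ j := by
    by_contra! hlt
    have hsum : ∑ k with k ≤ j, t k ≤ ∑ k with k < i, t k := by
      refine Finset.sum_le_sum_of_subset_of_nonneg (fun k hk => ?_) fun k _ _ => h k
      simp only [Finset.mem_filter, Finset.mem_univ, true_and] at hk ⊢
      order
    have h1 : ∑ k with k < i, t k < s := by
      by_contra! hle
      apply hi
      change lowerPart t s i = 0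
      rw [lowerPart, min_eq_right hle, min_eq_right, sub_self]
      rw [sum_le_eq]
      linarith [h i]
    apply hj
    change t j - lowerPart t s j = 0
    have h2 := sum_le_eq t j
    have h3 := h j
    rw [lowerPart, min_eq_left (by linarith), min_eq_left (by linarith)]
    linarith
  obtain ⟨i, ε⟩ := a
  obtain ⟨j, δ⟩ := b
  have h01 : ∀ ε : Fin (1 + 1), ε = 0 ∨ ε = 1 := by decide
  rcases h01 ε with rfl | rfl <;> rcases h01 δ with rfl | rfl
  · exact (le_total i j).imp (fun h => ⟨h, le_rfl⟩) fun h => ⟨h, le_rfl⟩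
  · exact Or.inl ⟨key i j ha hb, Fin.zero_le _⟩
  · exact Or.inr ⟨key j i hb ha, Fin.zero_le _⟩
  · exact (le_total i j).imp (fun h => ⟨h, le_rfl⟩) fun h => ⟨h, le_rfl⟩

end Coupling

section Prism

variable {n m : ℕ}

/-- The parametrization of `|Δ[n] ⊗ Δ[1]|` by the product of a topological simplex with the
interval. -/
noncomputable def prism (t : stdSimplex ℝ (Fin (n + 1))) (s : I) : |(Δ[n] ⊗ Δ[1] : SSet.{w})| :=
  (mem_range_prodRealizationWeight (coupling t s) (coupling_chain t s)).choose

theorem prodRealizationWeight_prism (t : stdSimplex ℝ (Fin (n + 1))) (s : I) :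
    prodRealizationWeight.{w} n 1 (prism t s) = coupling t s :=
  (mem_range_prodRealizationWeight (coupling t s) (coupling_chain t s)).choose_spec

theorem continuous_prism :
    Continuous fun q : stdSimplex ℝ (Fin (n + 1)) × I => prism.{w} q.1 q.2 := by
  rw [isClosedEmbedding_prodRealizationWeight.continuous_iff]
  exact continuous_coupling.congr fun q => (prodRealizationWeight_prism q.1 q.2).symm

theorem prodRealizationWeight_map (f : ⦋n⦌ ⟶ ⦋m⦌) (z : |(Δ[n] ⊗ Δ[1] : SSet.{w})|) :
    prodRealizationWeight m 1 ((SSet.toTop.map (SSet.stdSimplex.map f ▷ Δ[1])).hom z) =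
      stdSimplex.map (Prod.map f.toOrderHom id) (prodRealizationWeight n 1 z) := by
  obtain ⟨k, x, t, rfl⟩ := exists_realizationPoint_eq z
  rw [toTop_map_realizationPoint]
  erw [prodRealizationWeight_realizationPoint, prodRealizationWeight_realizationPoint]
  rw [stdSimplex.map_comp_apply]
  rfl

theorem prism_map (f : ⦋n⦌ ⟶ ⦋m⦌) (t : stdSimplex ℝ (Fin (n + 1))) (s : I) :
    prism.{w} (stdSimplex.map f.toOrderHom t) s =
      (SSet.toTop.map (SSet.stdSimplex.map f ▷ Δ[1])).hom (prism t s) := by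
  apply prodRealizationWeight_injective
  rw [prodRealizationWeight_map, prodRealizationWeight_prism, prodRealizationWeight_prism]
  exact coupling_map f.toOrderHom t s

/-- The simplex of `X ⊗ Δ[1]` over `x` whose second component is constant at the vertex `k`. -/
def endSimplex {X : SSet.{w}} {n : SimplexCategoryᵒᵖ} (x : X.obj n) (k : Fin 2) :
    (X ⊗ Δ[1] : SSet.{w}).obj n :=
  ⟨x, SSet.stdSimplex.const 1 k n⟩

theorem prism_eq_realizationPoint (t : stdSimplex ℝ (Fin (n + 1))) (s : I) (k : Fin 2)
    (h : coupling t s = stdSimplex.map (fun i => (i, k)) t) :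
    prism.{w} t s =
      realizationPoint (endSimplex (SSet.yonedaEquiv (𝟙 Δ[n])) k) t := by
  apply prodRealizationWeight_injective
  rw [prodRealizationWeight_prism, h]
  erw [prodRealizationWeight_realizationPoint]
  rfl

end Prism

open ContinuousMap in
/-- A simplicial homotopy induces a homotopy between the geometric realizations. -/
theorem homotopic_toTop_map {X Y : SSet.{w}} {f g : X ⟶ Y} (H : X ⊗ Δ[1] ⟶ Y)
    (h₀ : ∀ n (x : X.obj n), H.app n (endSimplex x 0) = f.app n x)
    (h₁ : ∀ n (x : X.obj n), H.app n (endSimplex x 1) = g.app n x) :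
    Homotopic (SSet.toTop.map f).hom (SSet.toTop.map g).hom := by
  let Φ {n : SimplexCategory} (x : X.obj (op n)) : |(Δ[n.len] ⊗ Δ[1] : SSet.{w})| → |Y| :=
    (SSet.toTop.map ((SSet.yonedaEquiv (n := ⦋n.len⦌)).symm x ▷ Δ[1] ≫ H)).hom
  have hΦ {n : SimplexCategory} (x : X.obj (op n)) (t : stdSimplex ℝ (Fin (n.len + 1))) (s : I)
      (k : Fin 2) (h : coupling t s = stdSimplex.map (fun i => (i, k)) t) :
      Φ x (prism t s) = realizationPoint (H.app _ (endSimplex x k)) t := by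
    rw [prism_eq_realizationPoint t s k h]
    refine (toTop_map_realizationPoint _ _ _).trans ?_
    congr 2
    change H.app _ _ = _
    congr 1
    exact Prod.ext (SSet.yonedaEquiv_symm_app_id (n := n.len) x) rfl
  have hΦmap {m n : SimplexCategory} (f : m ⟶ n) (x : X.obj (op n)) (z) :
      Φ (X.map f.op x) z =
        Φ x ((SSet.toTop.map
          (SSet.stdSimplex.map (X := ⦋m.len⦌) (Y := ⦋n.len⦌) f ▷ Δ[1])).hom z) := by
    have e : (SSet.yonedaEquiv (n := ⦋m.len⦌)).symm (X.map f.op x) ▷ Δ[1] ≫ H =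
        SSet.stdSimplex.map (X := ⦋m.len⦌) (Y := ⦋n.len⦌) f ▷ Δ[1] ≫
          (SSet.yonedaEquiv (n := ⦋n.len⦌)).symm x ▷ Δ[1] ≫ H := by
      rw [← comp_whiskerRight_assoc]
      congr 2
      exact (SSet.yonedaEquiv_symm_naturality_left (m := ⦋m.len⦌) (n := ⦋n.len⦌) f x).symm
    simp only [Φ]
    rw [e, Functor.map_comp]
    rfl
  obtain ⟨F, hF⟩ := exists_realization_desc (X := X) (Z := C(I, |Y|))
    (fun n x => ContinuousMap.curry
      ⟨fun q => Φ x (prism q.1 q.2), (ContinuousMap.continuous _).comp continuous_prism⟩)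
    (fun {m n} f x t => by
      ext s
      change Φ (X.map f.op x) (prism t s) = Φ x (prism (stdSimplex.map f.toOrderHom t) s)
      rw [hΦmap]
      exact congrArg (Φ x) (prism_map (n := m.len) (m := n.len) f t s).symm)
  have hF' (n : SimplexCategory) (x : X.obj (op n)) (t) (s : I) :
      F (realizationPoint x t) s = Φ x (prism t s) :=
    DFunLike.congr_fun (hF n x t) s
  have hend (s : I) (k : Fin 2) (e : X ⟶ Y) (he : ∀ n (x : X.obj n),
      H.app n (endSimplex x k) = e.app n x) (hs : ∀ (n : ℕ) (t : stdSimplex ℝ (Fin (n + 1))),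
        coupling t s = stdSimplex.map (fun i => (i, k)) t) (z : |X|) :
      F z s = (SSet.toTop.map e).hom z := by
    obtain ⟨n, x, t, rfl⟩ := exists_realizationPoint_eq z
    refine (hF' ⦋n⦌ x t s).trans ((hΦ (n := ⦋n⦌) x t s k (hs _ t)).trans ?_)
    rw [toTop_map_realizationPoint, he]
  refine Homotopic.symm ⟨?_⟩
  exact
    { toFun := fun q => F q.2 q.1
      continuous_toFun := by fun_prop
      map_zero_left := hend 0 1 g h₁ fun _ => coupling_zero
      map_one_left := hend 1 0 f h₀ fun _ => coupling_one }

end Realization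

/-! ### Homotopies between nerves -/

section Nerve

open Simplicial Opposite MonoidalCategory

universe v u

section NerveHomotopy

variable {C D : Type u} [Category.{v} C] [Category.{v} D] {F G : C ⥤ D}

/-- A natural transformation `F ⟶ G`, regarded as a functor on the product of `C` with the arrow
category, induces a simplicial homotopy between the nerves of `F` and `G`. -/
def nerveHomotopy (α : F ⟶ G) : nerve C ⊗ Δ[1] ⟶ nerve D where
  app n := ↾fun y =>
    (Functor.prod' ((SSet.stdSimplex.objEquiv y.2).toOrderHom.monotone.functor) y.1 ⋙
      Functor.uncurry.obj (ComposableArrows.mk₁ α) : Fin (n.unop.len + 1) ⥤ D)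
  naturality _ _ _ := rfl

theorem nerveHomotopy_zero (α : F ⟶ G) (n : SimplexCategoryᵒᵖ) (x : (nerve C).obj n) :
    (nerveHomotopy α).app n (endSimplex x 0) = (nerveMap F).app n x := by
  refine CategoryTheory.Functor.ext (fun i => rfl) fun i j f => ?_
  change 𝟙 (F.obj (x.obj i)) ≫ F.map (x.map f) = 𝟙 _ ≫ F.map (x.map f) ≫ 𝟙 _
  rw [Category.comp_id]

theorem nerveHomotopy_one (α : F ⟶ G) (n : SimplexCategoryᵒᵖ) (x : (nerve C).obj n) :
    (nerveHomotopy α).app n (endSimplex x 1) = (nerveMap G).app n x := by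
  refine CategoryTheory.Functor.ext (fun i => rfl) fun i j f => ?_
  change 𝟙 (G.obj (x.obj i)) ≫ G.map (x.map f) = 𝟙 _ ≫ G.map (x.map f) ≫ 𝟙 _
  rw [Category.comp_id]

theorem homotopic_toTop_map_nerveMap (α : F ⟶ G) :
    ContinuousMap.Homotopic (SSet.toTop.map (nerveMap F)).hom (SSet.toTop.map (nerveMap G)).hom :=
  homotopic_toTop_map (nerveHomotopy α) (nerveHomotopy_zero α) (nerveHomotopy_one α)

end NerveHomotopy

/-- The realization of a simplicial set with at most one simplex in every dimension has at most one
point. -/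
theorem subsingleton_toTop (X : SSet.{u}) [∀ n, Subsingleton (X.obj n)] : Subsingleton |X| := by
  -- Every simplex is a degeneracy of the unique vertex.
  have h (z : |X|) : ∃ x : X _⦋0⦌, realizationPoint x default = z := by
    obtain ⟨n, x, t, rfl⟩ := exists_realizationPoint_eq z
    let f : ⦋n⦌ ⟶ ⦋0⦌ := SimplexCategory.const ⦋n⦌ ⦋0⦌ 0
    let g : ⦋0⦌ ⟶ ⦋n⦌ := SimplexCategory.const ⦋0⦌ ⦋n⦌ 0
    refine ⟨X.map g.op x, ?_⟩
    have e := realizationPoint_map f (X.map g.op x) t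
    rw [Subsingleton.elim (X.map f.op (X.map g.op x)) x] at e
    rw [e]
    exact congrArg _ (Subsingleton.elim (α := stdSimplex ℝ (Fin 1)) _ _)
  refine ⟨fun z z' => ?_⟩
  obtain ⟨x, rfl⟩ := h z
  obtain ⟨x', rfl⟩ := h z'
  rw [Subsingleton.elim x x']

theorem subsingleton_toTop_nerve (D : Type u) [Category.{v} D] [Subsingleton D]
    [∀ a b : D, Subsingleton (a ⟶ b)] : Subsingleton |nerve D| := by
  have (n : SimplexCategoryᵒᵖ) : Subsingleton ((nerve D).obj n) :=
    ⟨fun x y => CategoryTheory.Functor.ext (fun i => Subsingleton.elim _ _)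
      fun i j f => Subsingleton.elim _ _⟩
  exact subsingleton_toTop _

theorem nonempty_toTop_nerve (D : Type u) [Category.{v} D] [Nonempty D] :
    Nonempty |nerve D| :=
  ⟨realizationPoint (n := ⦋0⦌) (ComposableArrows.mk₀ (Classical.arbitrary D)) default⟩

instance : Subsingleton Cat.chosenTerminal.{v, u} :=
  inferInstanceAs (Subsingleton (ULift.{u} (Discrete Unit)))

instance (a b : Cat.chosenTerminal.{v, u}) : Subsingleton (a ⟶ b) :=
  inferInstanceAs (Subsingleton (ULift.{v} (ULiftHom.objDown a.down ⟶ ULiftHom.objDown b.down)))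

instance : Nonempty Cat.chosenTerminal.{v, u} :=
  inferInstanceAs (Nonempty (ULift.{u} (Discrete Unit)))

/-- A category is aspherical as soon as its identity functor is related to a constant functor by
a zigzag of natural transformations through an endofunctor. -/
theorem isAspherical_of_natTrans {C : Type u} [Category.{v} C] (F : C ⥤ C) (c : C) (α : 𝟭 C ⟶ F)
    (β : (Functor.const C).obj c ⟶ F) : IsAspherical C := by
  let T := Cat.chosenTerminal.{v, u}
  let P : C ⥤ T := (Cat.chosenTerminalIsTerminal.{v, u}.from (Cat.of C)).toFunctor
  have : Subsingleton |nerve T| := subsingleton_toTop_nerve T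
  have : Nonempty |nerve T| := nonempty_toTop_nerve T
  obtain ⟨z⟩ := this
  have hT : ContractibleSpace |nerve T| := by
    have : Unique |nerve T| := { default := z, uniq := fun _ => Subsingleton.elim _ _ }
    infer_instance
  have hC : ContractibleSpace |nerve C| := by
    rw [contractible_iff_id_nullhomotopic]
    refine ⟨(SSet.toTop.map (nerveMap ((Functor.const T).obj c))).hom z, ?_⟩
    have h1 := (homotopic_toTop_map_nerveMap α).trans (homotopic_toTop_map_nerveMap β).symm
    have h2 : (SSet.toTop.map (nerveMap (𝟭 C))).hom = ContinuousMap.id |nerve C| := by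
      have : nerveMap (𝟭 C) = 𝟙 (nerve C) := rfl
      rw [this, CategoryTheory.Functor.map_id]
      rfl
    have h3 : (SSet.toTop.map (nerveMap ((Functor.const C).obj c))).hom =
        ContinuousMap.const _ ((SSet.toTop.map (nerveMap ((Functor.const T).obj c))).hom z) := by
      have : nerveMap ((Functor.const C).obj c) =
          nerveMap P ≫ nerveMap ((Functor.const T).obj c) := rfl
      rw [this, Functor.map_comp]
      ext y
      exact congrArg _ (Subsingleton.elim _ z)
    rwa [h2, h3] at h1
  exact isWeakHomotopyEquiv_of_contractible (X := |nerve C|) (Y := |nerve T|) _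

end Nerve

/-! ### Operads of trees -/

namespace Tree

section Order

variable (T : Tree)

/-- The relation between an input edge and the output edge of a vertex. -/
def Step (e e' : T.Edge) : Prop :=
  ∃ h : e ≠ T.root, T.output (T.below ⟨e, h⟩) = e'

/-- The order on the edges of a tree: `T.Le e e'` if descending from `e` one reaches `e'`. Thus the
root is the largest edge, although it is drawn at the bottom: below an edge are the larger ones. -/
def Le : T.Edge → T.Edge → Prop :=
  Relation.ReflTransGen T.Step

variable {T}

theorem Step.unique {e e₁ e₂ : T.Edge} (h₁ : T.Step e e₁) (h₂ : T.Step e e₂) : e₁ = e₂ := by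
  obtain ⟨_, rfl⟩ := h₁
  obtain ⟨_, rfl⟩ := h₂
  rfl

theorem le_refl (e : T.Edge) : T.Le e e :=
  .refl

theorem Le.trans {a b c : T.Edge} (h : T.Le a b) (h' : T.Le b c) : T.Le a c :=
  Relation.ReflTransGen.trans h h'

theorem Step.le {a b : T.Edge} (h : T.Step a b) : T.Le a b :=
  .single h

theorem le_root (e : T.Edge) : T.Le e T.root :=
  T.descend e

theorem eq_root_of_root_le {e : T.Edge} (h : T.Le T.root e) : e = T.root := by
  rcases Relation.ReflTransGen.cases_head h with h | ⟨_, ⟨h, _⟩, _⟩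
  · exact h.symm
  · exact absurd rfl h

/-- The edges below a given edge form a chain. -/
theorem Le.total_of_common {x a b : T.Edge} (ha : T.Le x a) (hb : T.Le x b) :
    T.Le a b ∨ T.Le b a :=
  Relation.ReflTransGen.total_of_right_unique (fun _ _ _ => Step.unique) ha hb

/-- Descending in a tree is acyclic: on a cycle one would never leave the cycle, and hence not
reach the root. -/
theorem Step.not_le {a b : T.Edge} (h : T.Step a b) : ¬ T.Le b a := by
  intro hba
  have key : ∀ x, T.Le a x → T.Le x a := fun x hx => by
    induction hx with
    | refl => exact le_refl a
    | tail _ hs ih =>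
      rcases Relation.ReflTransGen.cases_head ih with rfl | ⟨y, hy, hya⟩
      · rwa [hs.unique h]
      · rwa [hs.unique hy]
  have := eq_root_of_root_le (key _ (le_root a))
  exact h.1 this

theorem eq_of_le_of_le {a b : T.Edge} (h : T.Le a b) (h' : T.Le b a) : a = b := by
  rcases Relation.ReflTransGen.cases_head h with rfl | ⟨c, hc, hcb⟩
  · rfl
  · exact absurd (Le.trans hcb h') hc.not_le

theorem wellFounded_step (T : Tree) : WellFounded T.Step := by
  let r : T.Edge → T.Edge → Prop := fun a b => T.Le a b ∧ a ≠ b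
  have : IsTrans T.Edge r := ⟨fun a b c hab hbc => ⟨hab.1.trans hbc.1, by
    rintro rfl
    exact hab.2 (eq_of_le_of_le hab.1 hbc.1)⟩⟩
  have : Std.Irrefl r := ⟨fun a h => h.2 rfl⟩
  refine Subrelation.wf (r := r) (fun {a b} h => ⟨h.le, ?_⟩)
    (Finite.wellFounded_of_trans_of_irrefl r)
  rintro rfl
  exact h.not_le (le_refl _)

theorem Input.step {w : T.Vertex} (i : T.Input w) : T.Step i.1.1 (T.output w) :=
  ⟨i.1.2, congrArg T.output i.2⟩

theorem Step.exists_input {e : T.Edge} {w : T.Vertex} (h : T.Step e (T.output w)) :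
    ∃ i : T.Input w, i.1.1 = e := by
  obtain ⟨h, e'⟩ := h
  exact ⟨⟨⟨e, h⟩, T.output_injective e'⟩, rfl⟩

theorem Input.eq_of_le {w : T.Vertex} {i j : T.Input w} (h : T.Le i.1.1 j.1.1) : i = j := by
  rcases Relation.ReflTransGen.cases_head h with h | ⟨c, hc, hcj⟩
  · exact Subtype.ext (Subtype.ext h)
  · rw [hc.unique i.step] at hcj
    exact absurd hcj j.step.not_le

/-- Two inputs of a vertex that lie below a common edge coincide. -/
theorem Input.eq_of_common {w : T.Vertex} {i j : T.Input w} {x : T.Edge} (hi : T.Le x i.1.1)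
    (hj : T.Le x j.1.1) : i = j :=
  (hi.total_of_common hj).elim Input.eq_of_le fun h => (Input.eq_of_le h).symm

theorem exists_input_of_le_output {w : T.Vertex} {x : T.Edge} (h : T.Le x (T.output w))
    (hne : x ≠ T.output w) : ∃ i : T.Input w, T.Le x i.1.1 := by
  rcases Relation.ReflTransGen.cases_tail h with h | ⟨e, hxe, he⟩
  · exact absurd h.symm hne
  · obtain ⟨i, rfl⟩ := he.exists_input
    exact ⟨i, hxe⟩

/-- The paths from two incomparable edges to the root meet at a vertex, which they enter through
distinct inputs. -/
theorem exists_inputs_of_incomparable {a b : T.Edge} (hab : ¬ T.Le a b) (hba : ¬ T.Le b a) :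
    ∃ (w : T.Vertex) (i j : T.Input w), i ≠ j ∧ T.Le a i.1.1 ∧ T.Le b j.1.1 := by
  have key : ∀ x, T.Le b x → T.Le a x →
      ∃ (w : T.Vertex) (i j : T.Input w), i ≠ j ∧ T.Le a i.1.1 ∧ T.Le b j.1.1 := fun x hx => by
    induction hx with
    | refl => exact fun h => absurd h hab
    | @tail y z hy hs ih =>
      intro haz
      by_cases hay : T.Le a y
      · exact ih hay
      obtain ⟨hr, rfl⟩ := hs
      obtain ⟨i, hi⟩ := exists_input_of_le_output haz (by
        rintro rfl
        exact hba (hy.trans (Step.le ⟨hr, rfl⟩)))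
      refine ⟨_, i, ⟨⟨y, hr⟩, rfl⟩, ?_, hi, hy⟩
      rintro rfl
      exact hay hi
  exact key _ (le_root b) (le_root a)

end Order

section Terms

variable {T : Tree} {X : Type} [DecidableEq X] {c : X → T.collection.Color}

theorem le_of_count_ne_zero {d : T.collection.Color} (t : Term T.collection c d) (x : X)
    (h : t.count x ≠ 0) : T.Le (c x) d := by
  induction t with
  | var y e =>
    simp only [Term.count, ne_eq, ite_eq_right_iff, one_ne_zero, imp_false, not_not] at h
    subst h e
    exact le_refl _
  | node w t ih =>
    obtain ⟨i, -, hi⟩ := Finset.exists_ne_zero_of_sum_ne_zero h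
    exact (ih i hi).trans (Input.step i).le

/-- Distinct variables of a formal composite in a tree are incomparable edges, since they are
reached through distinct inputs of some vertex. -/
theorem eq_of_count_ne_zero_of_le {d : T.collection.Color} (t : Term T.collection c d) (x y : X)
    (hx : t.count x ≠ 0) (hy : t.count y ≠ 0) (h : T.Le (c x) (c y)) : x = y := by
  induction t with
  | var z e =>
    simp only [Term.count, ne_eq, ite_eq_right_iff, one_ne_zero, imp_false, not_not] at hx hy
    exact hx.symm.trans hy
  | node w t ih =>
    obtain ⟨i, -, hi⟩ := Finset.exists_ne_zero_of_sum_ne_zero hx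
    obtain ⟨j, -, hj⟩ := Finset.exists_ne_zero_of_sum_ne_zero hy
    obtain rfl : i = j := Input.eq_of_common (le_of_count_ne_zero _ x hi)
      (h.trans (le_of_count_ne_zero _ y hj))
    exact ih i hi hj

/-- A formal composite in a tree is determined by its output and the set of its variables. The two
output edges are allowed to differ syntactically, for the sake of the induction. -/
theorem term_heq {d d' : T.collection.Color} (t : Term T.collection c d)
    (t' : Term T.collection c d') (e : d = d')
    (h : ∀ x, t.count x ≠ 0 ↔ t'.count x ≠ 0) : HEq t t' := by
  have node_ne (w : T.Vertex) (s : ∀ i : T.Input w, Term T.collection c i.1.1) (x : X)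
      (hx : (Term.node (K := T.collection) w s).count x ≠ 0) : c x ≠ T.output w := by
    intro hw
    obtain ⟨i, -, hi⟩ := Finset.exists_ne_zero_of_sum_ne_zero hx
    exact (Input.step i).not_le (hw ▸ le_of_count_ne_zero _ x hi)
  induction t generalizing d' with
  | var x hx =>
    cases t' with
    | var y hy =>
      have : x = y := by
        have := (h x).1 (by simp [Term.count])
        simpa [Term.count, eq_comm] using this
      subst this hx hy
      rfl
    | node w s => exact absurd (hx.trans e) (node_ne w s x ((h x).1 (by simp [Term.count])))
  | node w s ih =>
    cases t' with
    | var y hy =>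
      exact absurd (hy.trans e.symm) (node_ne w s y ((h y).2 (by simp [Term.count])))
    | node w' s' =>
      obtain rfl : w = w' := T.output_injective e
      congr 1
      funext i
      refine eq_of_heq (ih i (s' i) rfl fun x => ?_)
      have aux (r r' : ∀ i : T.Input w, Term T.collection c i.1.1)
          (hr : (Term.node (K := T.collection) w r).count x ≠ 0 →
            (Term.node (K := T.collection) w r').count x ≠ 0)
          (hi : (r i).count x ≠ 0) : (r' i).count x ≠ 0 := by
        have hn : (Term.node (K := T.collection) w r).count x ≠ 0 := fun h0 =>
          hi (Finset.sum_eq_zero_iff.1 h0 i (Finset.mem_univ i))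
        obtain ⟨j, -, hj⟩ := Finset.exists_ne_zero_of_sum_ne_zero (hr hn)
        obtain rfl : i = j := Input.eq_of_common (le_of_count_ne_zero _ x hi)
          (le_of_count_ne_zero _ x hj)
        exact hj
      exact ⟨aux s s' (h x).1, aux s' s (h x).2⟩

/-- An operation of `Ω(T)` is determined by its inputs and its output. -/
theorem subsingleton_freeOp {n : ℕ} (c : Fin n → T.collection.Color) (d : T.collection.Color) :
    Subsingleton (FreeOp T.collection c d) :=
  ⟨fun p q => Subtype.ext (eq_of_heq (term_heq p.1 q.1 rfl fun x => by rw [p.2 x, q.2 x]))⟩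

/-- In a tree without leaves there is a formal composite with output `d` in any given pairwise
incomparable variables above `d`: it is obtained by ascending from `d` until a variable is met or
the branch ends. -/
theorem exists_term_of_surjective (hT : Function.Surjective T.output)
    (d : T.collection.Color) (S : Set X) [DecidablePred (· ∈ S)] (hd : ∀ x ∈ S, T.Le (c x) d)
    (hS : ∀ x ∈ S, ∀ y ∈ S, T.Le (c x) (c y) → x = y) :
    ∃ t : Term T.collection c d, ∀ x, t.count x = if x ∈ S then 1 else 0 := by
  classical
  induction d using (wellFounded_step T).induction generalizing S with
  | h d ih =>
    by_cases hx : ∃ x ∈ S, c x = d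
    · obtain ⟨x, hxS, rfl⟩ := hx
      refine ⟨.var x rfl, fun y => ?_⟩
      have : x = y ↔ y ∈ S :=
        ⟨fun h => h ▸ hxS, fun hy => (hS y hy x hxS (hd y hy)).symm⟩
      simp only [Term.count, this]
    · push Not at hx
      obtain ⟨w, rfl⟩ := hT d
      choose t ht using fun i : T.Input w => ih i.1.1 i.step {x ∈ S | T.Le (c x) i.1.1}
        (fun x h => h.2) fun x h y h' => hS x h.1 y h'.1
      refine ⟨Term.node (K := T.collection) w t, fun x => ?_⟩
      change ∑ i : T.Input w, (t i).count x = _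
      simp only [ht]
      split_ifs with hxS
      · obtain ⟨i, hi⟩ := exists_input_of_le_output (hd x hxS) (hx x hxS)
        rw [Finset.sum_eq_single i, if_pos ⟨hxS, hi⟩]
        · exact fun j _ hj => if_neg fun h => hj (Input.eq_of_common h.2 hi)
        · exact fun h => absurd (Finset.mem_univ i) h
      · exact Finset.sum_eq_zero fun i _ => if_neg fun h => hxS h.1

/-- Edges are the inputs of an operation with output `d` of the operad of a tree without leaves if
they are pairwise incomparable and lie above `d`. -/
theorem nonempty_freeOp (hT : Function.Surjective T.output) {n : ℕ} (c : Fin n → T.collection.Color)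
    (d : T.collection.Color) (hd : ∀ i, T.Le (c i) d) (hc : ∀ i j, T.Le (c i) (c j) → i = j) :
    Nonempty (FreeOp T.collection c d) := by
  obtain ⟨t, ht⟩ := exists_term_of_surjective hT d Set.univ (fun i _ => hd i)
    fun i _ j _ => hc i j
  exact ⟨⟨t, fun x => by rw [ht, if_pos (Set.mem_univ x)]⟩⟩

end Terms

section Morphisms

variable {S T : Tree}

/-- Since operations are determined by their inputs and outputs, morphisms are determined by their
values on edges. -/
theorem hom_ext {f g : S ⟶ T} (h : ∀ e, Operad.Hom.color f e = Operad.Hom.color g e) : f = g := by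
  obtain ⟨fc, fo, _, _, _⟩ := f
  obtain ⟨gc, go, _, _, _⟩ := g
  obtain rfl : fc = gc := funext h
  have : @fo = @go := by
    funext n c d p
    exact (subsingleton_freeOp (T := T) _ _).elim _ _
  subst this
  rfl

/-- A map on edges that preserves the order and incomparability extends to a morphism, if the
target has no leaves. -/
noncomputable def homOfEdgeMap (hT : Function.Surjective T.output) (φ : S.Edge → T.Edge)
    (hφ : ∀ a b, S.Le a b → T.Le (φ a) (φ b))
    (hφ' : ∀ a b, ¬ S.Le a b → ¬ S.Le b a → ¬ T.Le (φ a) (φ b)) : S ⟶ T :=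
  show Operad.Hom S.operad T.operad from
  { color := φ
    op := fun {n c d} p => Classical.choice <| nonempty_freeOp hT (fun i => φ (c i)) (φ d)
      (fun i => hφ _ _ (le_of_count_ne_zero p.1 i (by rw [p.2]; exact one_ne_zero)))
      fun i j h => by
        have hp (i j) : S.Le (c i) (c j) → i = j :=
          eq_of_count_ne_zero_of_le p.1 i j (by rw [p.2]; exact one_ne_zero)
            (by rw [p.2]; exact one_ne_zero)
        by_contra hij
        exact hφ' _ _ (fun h' => hij (hp i j h')) (fun h' => hij (hp j i h').symm) h
    map_reindex := fun _ _ _ => (subsingleton_freeOp _ _).elim _ _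
    map_unit := fun _ => (subsingleton_freeOp _ _).elim _ _
    map_comp := fun _ _ => (subsingleton_freeOp _ _).elim _ _ }

/-- The generating operation of a vertex, with its inputs in a chosen order. -/
theorem exists_generator (w : S.Vertex) :
    ∃ (n : ℕ) (s : Fin n ≃ S.Input w),
      Nonempty (FreeOp S.collection (fun k => (s k).1.1) (S.output w)) := by
  refine ⟨_, (Fintype.equivFin (S.Input w)).symm,
    ⟨Term.node (K := S.collection) w fun i =>
      .var (Fintype.equivFin (S.Input w) i) 
        (congrArg (fun i : S.Input w => i.1.1) (Equiv.symm_apply_apply _ i)), fun x => ?_⟩⟩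
  change ∑ i : S.Input w, (if Fintype.equivFin (S.Input w) i = x then 1 else 0) = 1
  rw [Finset.sum_eq_single ((Fintype.equivFin (S.Input w)).symm x)]
  · simp
  · intro i _ hi
    rw [if_neg]
    rintro rfl
    exact hi (Equiv.symm_apply_apply _ _).symm
  · simp

/-- A morphism sends the inputs of a vertex to pairwise incomparable edges above the image of its
output, because it sends the generator of the vertex to an operation. -/
theorem hom_inputs (f : S ⟶ T) (w : S.Vertex) :
    (∀ i : S.Input w,
      T.Le (Operad.Hom.color f i.1.1) (Operad.Hom.color f (S.output w))) ∧
    ∀ i j : S.Input w, T.Le (Operad.Hom.color f i.1.1) (Operad.Hom.color f j.1.1) → i = j := by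
  obtain ⟨n, s, ⟨p⟩⟩ := exists_generator w
  let q : FreeOp T.collection _ _ := Operad.Hom.op f p
  have hq (k) : q.1.count k ≠ 0 := by rw [q.2]; exact one_ne_zero
  constructor
  · intro i
    obtain ⟨k, rfl⟩ := s.surjective i
    exact le_of_count_ne_zero q.1 k (hq k)
  · intro i j h
    obtain ⟨k, rfl⟩ := s.surjective i
    obtain ⟨l, rfl⟩ := s.surjective j
    exact congrArg s (eq_of_count_ne_zero_of_le q.1 k l (hq k) (hq l) h)

theorem hom_le (f : S ⟶ T) {a b : S.Edge} (h : S.Le a b) :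
    T.Le (Operad.Hom.color f a) (Operad.Hom.color f b) := by
  induction h with
  | refl => exact le_refl _
  | tail _ hs ih =>
    obtain ⟨hr, rfl⟩ := hs
    exact ih.trans ((hom_inputs f _).1 ⟨⟨_, hr⟩, rfl⟩)

/-- Incomparability is preserved, because it is witnessed by two distinct inputs of a vertex. -/
theorem hom_incomparable (f : S ⟶ T) {a b : S.Edge} (hab : ¬ S.Le a b) (hba : ¬ S.Le b a) :
    ¬ T.Le (Operad.Hom.color f a) (Operad.Hom.color f b) := by
  obtain ⟨w, i, j, hij, hi, hj⟩ := exists_inputs_of_incomparable hab hba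
  intro h
  rcases (hom_le f hi).total_of_common (h.trans (hom_le f hj)) with h | h
  · exact hij ((hom_inputs f w).2 i j h)
  · exact hij ((hom_inputs f w).2 j i h).symm

end Morphisms

section Closure

open Classical in
/-- The tree obtained from `T` by closing every leaf with a vertex without inputs and by adding a
vertex with the single input `T.root` at the bottom. Its edges are those of `T` and a new root
`none`, and every edge is the output of a vertex, so that vertices can be identified with edges. -/
noncomputable def closure (T : Tree) : Tree where
  Edge := Option T.Edge
  Vertex := Option T.Edge
  finite_edge := inferInstance
  root := none
  output := id
  output_injective := Function.injective_id
  below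
    | ⟨none, h⟩ => absurd rfl h
    | ⟨some e, _⟩ => if h : e = T.root then none else some (T.output (T.below ⟨e, h⟩))
  descend := by
    rintro (_ | e)
    · exact .refl
    · refine Relation.ReflTransGen.trans (b := some T.root) ?_
        (.single ⟨Option.some_ne_none _, dif_pos rfl⟩)
      refine Relation.ReflTransGen.lift some ?_ _ _ (T.descend e)
      rintro a b ⟨h, rfl⟩
      exact ⟨Option.some_ne_none _, dif_neg h⟩

theorem closure_output_surjective (T : Tree) : Function.Surjective T.closure.output :=
  Function.surjective_id

variable {T : Tree}

theorem closure_step_some {a : T.Edge} {x : Option T.Edge} (h : T.closure.Step (some a) x) :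
    a = T.root ∧ x = none ∨ ∃ b, x = some b ∧ T.Step a b := by
  classical
  obtain ⟨_, h⟩ := h
  change (if h : a = T.root then none else some (T.output (T.below ⟨a, h⟩))) = x at h
  split_ifs at h with ha
  · exact Or.inl ⟨ha, h.symm⟩
  · exact Or.inr ⟨_, h.symm, ha, rfl⟩

theorem closure_le_some {a b : T.Edge} : T.closure.Le (some a) (some b) ↔ T.Le a b := by
  classical
  constructor
  · have key : ∀ x y : Option T.Edge, T.closure.Le x y → ∀ a b, x = some a → y = some b →
        T.Le a b := by
      intro x y h
      induction h using Relation.ReflTransGen.head_induction_on with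
      | refl =>
        rintro a b rfl h
        rw [Option.some.inj h]
        exact le_refl _
      | @head x z hs hz ih =>
        rintro a b rfl rfl
        rcases closure_step_some hs with ⟨_, rfl⟩ | ⟨a', rfl, ha'⟩
        · exact absurd (eq_root_of_root_le (T := T.closure) hz) (Option.some_ne_none b)
        · exact ha'.le.trans (ih a' b rfl rfl)
    exact fun h => key _ _ h a b rfl rfl
  · refine Relation.ReflTransGen.lift some ?_ _ _
    rintro a b ⟨h, rfl⟩
    exact ⟨Option.some_ne_none _, dif_neg h⟩

theorem closure_le_none (x : Option T.Edge) : T.closure.Le x none :=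
  le_root (T := T.closure) x

/-- The closure is functorial: morphisms of trees preserve the order and incomparability. -/
noncomputable def closureMap {S T : Tree} (f : S ⟶ T) : S.closure ⟶ T.closure :=
  homOfEdgeMap T.closure_output_surjective (Option.map (Operad.Hom.color f))
    (by
      rintro (_ | a) (_ | b) h
      · exact le_refl _
      · exact absurd (eq_root_of_root_le (T := S.closure) h) (Option.some_ne_none b)
      · exact closure_le_none _
      · exact closure_le_some.2 (hom_le f (closure_le_some.1 h)))
    (by
      rintro (_ | a) (_ | b) h h'
      · exact absurd (closure_le_none _) h
      · exact absurd (closure_le_none _) h'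
      · exact absurd (closure_le_none _) h
      · exact fun h'' => hom_incomparable f (fun k => h (closure_le_some.2 k))
          (fun k => h' (closure_le_some.2 k)) (closure_le_some.1 h''))

/-- The closure as an endofunctor of the category of trees. -/
noncomputable def closureFunctor : Tree ⥤ Tree where
  obj := closure
  map := closureMap
  map_id T := hom_ext fun (e : Option T.Edge) => congrFun Option.map_id e
  map_comp f g := hom_ext fun (e : Option _) =>
    (Option.map_map (Operad.Hom.color g) (Operad.Hom.color f) e).symm

/-- The inclusion of a tree in its closure. -/
noncomputable def toClosure : 𝟭 Tree ⟶ closureFunctor where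
  app T := homOfEdgeMap (S := T) T.closure_output_surjective some
    (fun _ _ h => closure_le_some.2 h) fun _ _ h _ h'' => h (closure_le_some.1 h'')
  naturality _ _ _ := hom_ext fun _ => rfl

/-- The tree with a single edge and no vertex. -/
def edge : Tree where
  Edge := Unit
  Vertex := Empty
  finite_edge := inferInstance
  root := ()
  output := Empty.elim
  output_injective := fun a => a.elim
  below := fun e => absurd rfl e.2
  descend := fun _ => .refl

/-- The inclusion of the new root in the closure. It is natural because the closure of a morphism
preserves the new root. -/
noncomputable def rootToClosure : (Functor.const Tree).obj edge ⟶ closureFunctor where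
  app T := homOfEdgeMap (S := edge) T.closure_output_surjective (fun _ => none)
    (fun _ _ _ => le_refl (T := T.closure) _) fun a _ h _ _ => h (le_refl (T := edge) a)
  naturality _ _ _ := hom_ext fun _ => rfl

end Closure
end Tree

end Dendroidal

/-- The category `Ω` of trees is aspherical. -/
theorem mainTheorem4 : Dendroidal.IsAspherical Dendroidal.Tree := by
  exact Dendroidal.isAspherical_of_natTrans Dendroidal.Tree.closureFunctor Dendroidal.Tree.edge
    Dendroidal.Tree.toClosure Dendroidal.Tree.rootToClosure
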